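/- **Notation.** For real $x\ge 1$ let $[x]=\{0,1,\dots,\lfloor x-1\rfloor\}$, and write $\mathbb E_{z\in S}$ for the average over a finite nonempty set $S$. Let $P\in\mathbb Z[z]$ be a polynomial with an integer root $\rho$ of multiplicity $1$, let $d=\deg P$, and write $P(z+\rho)=\beta_dz^d+\dots+\beta_1z$, so that $\beta_1,\beta_d\ne0$. For a real $w>10$ let $W=\prod_{p<w,\ p\text{ prime}}p$, and let $$\widetilde P(z)=\frac{P(\beta_1Wz+\rho)}{\beta_1^2W}\in\mathbb Z[z].$$ For a positive integer $V$ and $r\in[V]$ let $$\widetilde P_{[r,V]}(z)=\frac{\widetilde P(Vz+r)-\widetilde P(r)}{V}\in\mathbb Z[z];$$ it has degree $d$, and $V_d=\beta_d\beta_1^{d-2}W^{d-1}V^{d-1}$ denotes its leading coefficient. For a positive integer $N$ put $K=(N/|V_d|)^{1/d}$. A function $f:\mathbb Z^D\to\mathbb C$ is $1$-bounded if $|f|\le1$ everywhere. **Statement.** For every $P,\rho$ as above and every $C_1>0$ there exists $C_2>0$, depending only on $C_1$ and $P$, such that for every integer $D\ge1$ and every $B$ there exists $A>0$, depending only on $C_1,P,D,B$,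 such that the following holds. Let $w>10$ be real, let $\delta\in(0,1/10)$, let $V\le W^{C_1}$ be a nonnegative integer power of $W$, let $r\in[V]$, let $N\ge C_2|V_d|^{C_2}\delta^{-C_2}$ be an integer, and let $\mathbf v\in\mathbb Z^D$ have all coordinates of absolute value at most $B$. Let $f_0,f_1:\mathbb Z^D\to\mathbb C$ be $1$-bounded functions supported on $[N]^D$ with $$\Bigl|\sum_{\mathbf x\in\mathbb Z^D}\mathbb E_{z\in[K]}f_0(\mathbf x)\,f_1\bigl(\mathbf x+\mathbf v\,\widetilde P_{[r,V]}(z)\bigr)\Bigr|\ge\delta N^D .$$ Then for each $i\in\{0,1\}$ there exists a positive integer $q_i\le A\delta^{-A}$ such that $$\sum_{\mathbf x\in\mathbb Z^D}\bigl|\mathbb E_{z\in[N']}f_i(\mathbf x+q_i\mathbf v z)\bigr|\ge A^{-1}\delta^{A}N^D\qquad\text{for all } 1\le N'\le\delta^{A}N .$$ -/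

import Mathlib

open Polynomial
open scoped BigOperators

namespace PolyCorners

/-- The convention `[x] = {0, 1, …, ⌊x - 1⌋}` for a real number `x`; in particular
`[N] = {0, …, N - 1}` for a positive integer `N`. -/
noncomputable def seg (x : ℝ) : Finset ℤ := Finset.Icc 0 ⌊x - 1⌋

/-- `W`, the product of all primes `p < w`. -/
noncomputable def primeProd (w : ℝ) : ℕ :=
  ∏ p ∈ (Finset.range ⌈w⌉₊).filter Nat.Prime, p

/-- Division of every coefficient of an integer polynomial by the integer `a`. It is only used where
all these divisions are exact, see `C_mul_wTrick` and `C_mul_vTrick`. -/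
noncomputable def coeffDiv (Q : ℤ[X]) (a : ℤ) : ℤ[X] :=
  ∑ i ∈ Q.support, monomial i (Q.coeff i / a)

/-- The coefficient `β_i` in the expansion `P(z + ρ) = β_d z^d + ⋯ + β_1 z + β_0` around `ρ`. -/
noncomputable def beta (P : ℤ[X]) (ρ : ℤ) (i : ℕ) : ℤ := (P.comp (X + C ρ)).coeff i

/-- The `W`-tricked polynomial `P(β₁ W z + ρ) / (β₁² W)` attached to a root `ρ` of `P`. -/
noncomputable def wTrick (P : ℤ[X]) (ρ : ℤ) (W : ℕ) : ℤ[X] :=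
  coeffDiv (P.comp (C (beta P ρ 1 * W) * X + C ρ)) (beta P ρ 1 ^ 2 * W)

/-- The `V`-tricked polynomial `Q_{[r,V]}(z) = (Q(V z + r) - Q(r)) / V`. -/
noncomputable def vTrick (Q : ℤ[X]) (r V : ℕ) : ℤ[X] :=
  coeffDiv (Q.comp (C (V : ℤ) * X + C (r : ℤ)) - C (Q.eval (r : ℤ))) V

/-- The scale `K = (N / |V_d|)^{1/d}`, where `d` and `V_d` are the degree and the leading coefficient
of the polynomial `Q`. -/
noncomputable def scale (Q : ℤ[X]) (N : ℕ) : ℝ :=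
  ((N : ℝ) / |(Q.leadingCoeff : ℝ)|) ^ ((1 : ℝ) / (Q.natDegree : ℝ))

/-- `f` is bounded by `1` in absolute value. -/
def OneBounded {D : ℕ} (f : (Fin D → ℤ) → ℂ) : Prop := ∀ x, ‖f x‖ ≤ 1

/-- `f` is supported on the box `[N]^D`. -/
def SupportedOnBox {D : ℕ} (N : ℕ) (f : (Fin D → ℤ) → ℂ) : Prop :=
  ∀ x, f x ≠ 0 → ∀ j, x j ∈ seg N

/-- The two-point count `∑_x 𝔼_{z ∈ [K]} f₀(x) f₁(x + v Q(z))` over `x ∈ ℤ^D`. The sum has only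
finitely many non-zero terms when `f₀` is supported on a box. -/
noncomputable def twoPointCount {D : ℕ} (Q : ℤ[X]) (N : ℕ) (v : Fin D → ℤ)
    (f₀ f₁ : (Fin D → ℤ) → ℂ) : ℂ :=
  ∑' x : Fin D → ℤ, 𝔼 z ∈ seg (scale Q N), f₀ x * f₁ (x + Q.eval z • v)

/-- `∑_x |𝔼_{z ∈ [N']} f(x + q v z)|` over `x ∈ ℤ^D`. The sum has only finitely many non-zero terms
when `f` is supported on a box. -/
noncomputable def progressionMean {D : ℕ} (q : ℕ) (N' : ℝ) (v : Fin D → ℤ)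
    (f : (Fin D → ℤ) → ℂ) : ℝ :=
  ∑' x : Fin D → ℤ, ‖𝔼 z ∈ seg N', f (x + ((q : ℤ) * z) • v)‖

theorem coeff_coeffDiv (Q : ℤ[X]) (a : ℤ) (i : ℕ) : (coeffDiv Q a).coeff i = Q.coeff i / a := by
  unfold coeffDiv
  rw [finsetSum_coeff]
  simp only [coeff_monomial]
  rw [Finset.sum_ite_eq']
  split_ifs with h
  · rfl
  · rw [notMem_support_iff.1 h, Int.zero_ediv]

theorem C_mul_coeffDiv (Q : ℤ[X]) (a : ℤ) (h : ∀ i, a ∣ Q.coeff i) : C a * coeffDiv Q a = Q := by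
  ext i
  rw [coeff_C_mul, coeff_coeffDiv, Int.mul_ediv_cancel' (h i)]

theorem coeff_comp_affine (Q : ℤ[X]) (a b : ℤ) (i : ℕ) :
    (Q.comp (C a * X + C b)).coeff i = (Q.comp (X + C b)).coeff i * a ^ i := by
  have : Q.comp (C a * X + C b) = (Q.comp (X + C b)).comp (C a * X) := by
    rw [comp_assoc]; simp
  rw [this, comp_C_mul_X_coeff]

/-- All divisions in the definition of the `W`-tricked polynomial are exact. -/
theorem C_mul_wTrick (P : ℤ[X]) (ρ : ℤ) (W : ℕ) (hρ : P.eval ρ = 0) :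
    C (beta P ρ 1 ^ 2 * (W : ℤ)) * wTrick P ρ W = P.comp (C (beta P ρ 1 * W) * X + C ρ) := by
  apply C_mul_coeffDiv
  intro i
  rw [coeff_comp_affine]
  match i with
  | 0 => simp [coeff_zero_eq_eval_zero, hρ]
  | 1 => exact ⟨1, by unfold beta; ring⟩
  | n + 2 =>
    exact ⟨beta P ρ (n + 2) * beta P ρ 1 ^ n * (W : ℤ) ^ (n + 1), by unfold beta; ring⟩

/-- All divisions in the definition of the `V`-tricked polynomial are exact. -/
theorem C_mul_vTrick (Q : ℤ[X]) (r V : ℕ) :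
    C (V : ℤ) * vTrick Q r V = Q.comp (C (V : ℤ) * X + C (r : ℤ)) - C (Q.eval (r : ℤ)) := by
  apply C_mul_coeffDiv
  intro i
  rw [coeff_sub, coeff_comp_affine]
  match i with
  | 0 => simp [coeff_zero_eq_eval_zero]
  | n + 1 =>
    rw [coeff_C_succ, sub_zero]
    exact ⟨(Q.comp (X + C (r : ℤ))).coeff (n + 1) * (V : ℤ) ^ n, by ring⟩

end PolyCorners

/-!
The argument is Fourier analysis on `ℤ^D` along the direction `v`. If `u = e(ξ · v)`, averaging over
the shifts `x ↦ x + Q(z) v` multiplies the Fourier transform at `ξ` by the Weyl sum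
`𝔼_{z ∈ [K]} u ^ Q(z)`, where `Q` is the polynomial `vTrick (wTrick P ρ W) r V`. By Cauchy–Schwarz,
a large two-point count forces each of the two functions to have large energy
`∑_x |𝔼_z f(x + Q(z) v)|²` (`le_tsum_norm_expect_sq`; for `f₀` the shifts are by `-Q(z) v`, and the
energy does not see the sign because the multiplier is merely conjugated). By Plancherel a
non-negligible part of the mass of the transform of `f` then sits on those `ξ` for which the Weyl
sum is at least `δ / 2`.

The arithmetic input (`exists_major_arc`) is that such a `u` satisfies `u ^ q ≈ 1`, up to
`δ^{-O(1)} / N`, for some `q ≤ δ^{-O(1)}` with constants that do not depend on `W` or `V`. Weyl's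
inequality (`weyl_inequality`) with losses polynomial in `1 / δ` alone gives a rational approximation
to the frequency with denominator dividing `q L`, where `L` is the leading coefficient of `Q`. This
`L` is huge, but up to a factor depending only on `P` it is a power of `W`; on the other hand
`Q = X + W G` is congruent to `X` modulo `W`, so that complete exponential sums of `Q` vanish for
every denominator having a common factor with `W` (`sum_e_rat_eq_zero`). As `[K]` is, up to
a short remainder, a union of complete blocks, the reduced denominator is coprime to `W`
(`exists_approx_of_large_sum`), hence divides `q` times a constant.

Finally, by pigeonhole a single `q` serves a non-negligible part of the mass, and for `N' ≤ δ^A N`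
the multiplier `𝔼_{z ∈ [N']} u ^ (q z)` is at least `1 / 2` there (`exists_progression_energy`).

Weyl's inequality is proved by induction on the degree. One differencing step gives, for many `h`, a
rational approximation to `h` times the leading coefficient; `exists_approx_of_recurrent`, a lemma of
Vinogradov type, removes the factor `h`. This avoids the divisor bound, whose loss of `K^ε` would be
fatal here.
-/

namespace PolyCorners

/-! ### Additive characters, polynomial growth and recurrence -/

/-- The additive character `e(x) = exp(2πix)`. -/
noncomputable def e (x : ℝ) : ℂ := Complex.exp (((2 * Real.pi * x : ℝ) : ℂ) * Complex.I)

theorem e_add (x y : ℝ) : e (x + y) = e x * e y := by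
  unfold e
  rw [← Complex.exp_add]
  congr 1
  push_cast
  ring

@[simp] theorem e_zero : e 0 = 1 := by simp [e]

@[simp] theorem norm_e (x : ℝ) : ‖e x‖ = 1 := by
  unfold e
  exact Complex.norm_exp_ofReal_mul_I _

theorem e_intCast (n : ℤ) : e n = 1 := by
  unfold e
  rw [Complex.exp_eq_one_iff]
  exact ⟨n, by push_cast; ring⟩

theorem e_neg (x : ℝ) : e (-x) = (starRingEnd ℂ) (e x) := by
  unfold e
  rw [← Complex.exp_conj]
  congr 1
  rw [map_mul, Complex.conj_ofReal, Complex.conj_I]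
  push_cast
  ring

theorem e_sub (x y : ℝ) : e (x - y) = e x * (starRingEnd ℂ) (e y) := by
  rw [sub_eq_add_neg, e_add, e_neg]

theorem norm_e_sub_one_le (x : ℝ) : ‖e x - 1‖ ≤ 2 * Real.pi * |x| := by
  unfold e
  have h := Real.norm_exp_I_mul_ofReal_sub_one_le (x := 2 * Real.pi * x)
  rw [mul_comm] at h
  refine h.trans ?_
  rw [Real.norm_eq_abs, abs_mul, abs_of_pos Real.two_pi_pos]

theorem norm_e_sub_e_le (x y : ℝ) : ‖e x - e y‖ ≤ 2 * Real.pi * |x - y| := by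
  have h : e x - e y = e y * (e (x - y) - 1) := by
    rw [mul_sub, ← e_add]; simp
  rw [h, norm_mul, norm_e, one_mul]
  exact norm_e_sub_one_le _

theorem four_mul_le_norm_e_sub_one (x : ℝ) (a : ℤ) (h : |x - a| ≤ 1 / 2) :
    4 * |x - a| ≤ ‖e x - 1‖ := by
  have h1 : e x = e (x - a) := by
    have := e_add (x - a) a
    rw [e_intCast, mul_one] at this
    rw [← this]; ring_nf
  rw [h1]
  unfold e
  rw [mul_comm _ Complex.I, Complex.norm_exp_I_mul_ofReal_sub_one, norm_mul, Real.norm_eq_abs,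
    Real.norm_eq_abs,
    abs_of_pos (by norm_num : (0:ℝ) < 2)]
  have h2 : 2 * Real.pi * (x - a) / 2 = Real.pi * (x - a) := by ring
  rw [h2]
  have h3 : |Real.pi * (x - a)| ≤ Real.pi / 2 := by
    rw [abs_mul, abs_of_pos Real.pi_pos]
    nlinarith [Real.pi_pos]
  have h4 := Real.mul_abs_le_abs_sin h3
  rw [abs_mul, abs_of_pos Real.pi_pos] at h4
  have h5 : 2 / Real.pi * (Real.pi * |x - a|) = 2 * |x - a| := by
    field_simp
  linarith

/-- `F` is nonnegative and at most polynomially large on `[1, ∞)`. One natural number serves as both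
the constant and the exponent of the bound. -/
def PolyGrowth (F : ℝ → ℝ) : Prop := ∃ C : ℕ, ∀ t : ℝ, 1 ≤ t → 0 ≤ F t ∧ F t ≤ C * t ^ C

namespace PolyGrowth

theorem const {c : ℝ} (hc : 0 ≤ c) : PolyGrowth fun _ => c := by
  refine ⟨⌈c⌉₊, fun t ht => ⟨hc, ?_⟩⟩
  calc c ≤ (⌈c⌉₊ : ℝ) * 1 := by rw [mul_one]; exact Nat.le_ceil c
    _ ≤ _ := by gcongr; exact one_le_pow₀ ht

theorem self : PolyGrowth fun t => t :=
  ⟨1, fun t ht => ⟨by linarith, by simp⟩⟩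

theorem add {F G : ℝ → ℝ} (hF : PolyGrowth F) (hG : PolyGrowth G) :
    PolyGrowth fun t => F t + G t := by
  obtain ⟨a, ha⟩ := hF
  obtain ⟨b, hb⟩ := hG
  refine ⟨a + b, fun t ht => ⟨add_nonneg (ha t ht).1 (hb t ht).1, ?_⟩⟩
  calc F t + G t ≤ a * t ^ a + b * t ^ b := add_le_add (ha t ht).2 (hb t ht).2
    _ ≤ a * t ^ (a + b) + b * t ^ (a + b) := by
        gcongr <;> first | exact ht | omega
    _ = _ := by push_cast; ring

theorem mul {F G : ℝ → ℝ} (hF : PolyGrowth F) (hG : PolyGrowth G) :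
    PolyGrowth fun t => F t * G t := by
  obtain ⟨a, ha⟩ := hF
  obtain ⟨b, hb⟩ := hG
  refine ⟨a * b + a + b, fun t ht => ⟨mul_nonneg (ha t ht).1 (hb t ht).1, ?_⟩⟩
  calc F t * G t ≤ (a * t ^ a) * (b * t ^ b) :=
        mul_le_mul (ha t ht).2 (hb t ht).2 (hb t ht).1 ((ha t ht).1.trans (ha t ht).2)
    _ = (a * b : ℕ) * t ^ (a + b) := by push_cast; ring
    _ ≤ _ := by
        have h1 : a * b ≤ a * b + a + b := by omega
        have h2 : a + b ≤ a * b + a + b := by nlinarith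
        gcongr

theorem pow {F : ℝ → ℝ} (hF : PolyGrowth F) (n : ℕ) : PolyGrowth fun t => F t ^ n := by
  induction n with
  | zero => simpa using const zero_le_one
  | succ k ih => simpa only [pow_succ] using ih.mul hF

end PolyGrowth

theorem card_le_of_abs_le (S : Finset ℤ) (Y : ℝ) (hY : 0 ≤ Y) (h : ∀ s ∈ S, |(s : ℝ)| ≤ Y) :
    (S.card : ℝ) ≤ 2 * Y + 1 := by
  have hsub : S ⊆ Finset.Icc (-⌊Y⌋) ⌊Y⌋ := by
    intro s hs
    have h1 := abs_le.1 (h s hs)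
    rw [Finset.mem_Icc]
    refine ⟨?_, Int.le_floor.2 h1.2⟩
    have : -s ≤ ⌊Y⌋ := Int.le_floor.2 (by push_cast; linarith)
    linarith
  have h2 := Finset.card_le_card hsub
  have h0 : 0 ≤ ⌊Y⌋ := Int.floor_nonneg.2 hY
  have h3 : ((Finset.Icc (-⌊Y⌋) ⌊Y⌋).card : ℤ) = 2 * ⌊Y⌋ + 1 := by
    rw [Int.card_Icc]; omega
  have h4 : (S.card : ℤ) ≤ 2 * ⌊Y⌋ + 1 := by rw [← h3]; exact_mod_cast h2
  have h5 : (S.card : ℝ) ≤ 2 * (⌊Y⌋ : ℝ) + 1 := by exact_mod_cast h4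
  linarith [Int.floor_le Y]

theorem card_le_of_sub_le (S : Finset ℕ) (X : ℝ) (hX : 0 ≤ X)
    (h : ∀ s ∈ S, ∀ t ∈ S, ((s : ℝ) - t) ≤ X) : (S.card : ℝ) ≤ X + 1 := by
  rcases S.eq_empty_or_nonempty with rfl | hne
  · simp; linarith
  have hsub : S ⊆ Finset.Icc (S.min' hne) (S.min' hne + ⌊X⌋₊) := by
    intro s hs
    rw [Finset.mem_Icc]
    refine ⟨S.min'_le s hs, ?_⟩
    have h1 := h s hs _ (S.min'_mem hne)
    have h2 : s - S.min' hne ≤ ⌊X⌋₊ := by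
      apply Nat.le_floor
      rw [Nat.cast_sub (S.min'_le s hs)]
      exact h1
    omega
  have h2 := Finset.card_le_card hsub
  rw [Nat.card_Icc] at h2
  have h3 : S.card ≤ ⌊X⌋₊ + 1 := by omega
  have h4 : (S.card : ℝ) ≤ (⌊X⌋₊ : ℝ) + 1 := by exact_mod_cast h3
  linarith [Nat.floor_le hX]

/-- Recurrence lemma of Vinogradov type: if a set `T` of density `1 / Λ` in `[K]` consists of `h` for
which `h β` is within `ε` of an integer, with `ε` small in terms of `Λ`, then for some `q = O(Λ)` the
distance of `q β` to the integers is smaller by a further factor of about `K`. The `q` is a gap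
between two elements of `T`; were `q β` not so close to an integer, the multiples of `β` along `T`
would be spread too evenly. -/
theorem exists_approx_of_recurrent (β ε Λ : ℝ) (K : ℕ) (T : Finset ℕ) (hΛ : 1 ≤ Λ) (hε : 0 ≤ ε)
    (hε' : 48 * Λ ^ 2 * ε ≤ 1) (hT : T ⊆ Finset.range K) (hKT : (K : ℝ) ≤ Λ * T.card)
    (hK : 2 * Λ < K) (hrec : ∀ h ∈ T, ∃ n : ℤ, |h * β - n| ≤ ε) :
    ∃ q : ℕ, 0 < q ∧ (q : ℝ) ≤ 3 * Λ ∧ ∃ a : ℤ, |q * β - a| * K ≤ 48 * Λ ^ 2 * ε := by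
  choose! n hn using hrec
  have hΛ0 : 0 < Λ := by linarith
  -- two elements of `T` at distance `O(Λ)`
  obtain ⟨h, hh, h', hh', hlt, hgap⟩ : ∃ h ∈ T, ∃ h' ∈ T, h < h' ∧ ((h' - h : ℕ) : ℝ) ≤ 3 * Λ := by
    set m := ⌈2 * Λ⌉₊ with hm
    have hm1 : 2 * Λ ≤ m := Nat.le_ceil _
    have hm2 : (m : ℝ) < 2 * Λ + 1 := Nat.ceil_lt_add_one (by linarith)
    have hmpos : 0 < m := Nat.ceil_pos.2 (by linarith)
    have hcard : (Finset.range (K / m + 1)).card < T.card := by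
      rw [Finset.card_range]
      have h1 : ((K / m + 1 : ℕ) : ℝ) < T.card := by
        have h2 : ((K / m : ℕ) : ℝ) ≤ K / (2 * Λ) := by
          refine Nat.cast_div_le.trans ?_
          gcongr
        have h3 : (K : ℝ) / Λ ≤ T.card := by rw [div_le_iff₀ hΛ0]; linarith
        have h4 : (K : ℝ) / Λ = K / (2 * Λ) + K / (2 * Λ) := by field_simp; norm_num
        have h5 : 1 < (K : ℝ) / (2 * Λ) := by rw [lt_div_iff₀ (by linarith)]; linarith
        push_cast at *
        linarith
      exact_mod_cast h1
    have hmaps : ∀ h ∈ T, h / m ∈ Finset.range (K / m + 1) := by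
      intro h hh
      have := Finset.mem_range.1 (hT hh)
      exact Finset.mem_range.2 (Nat.lt_succ_of_le (Nat.div_le_div_right this.le))
    obtain ⟨x, hx, y, hy, hxy, hdiv⟩ := Finset.exists_ne_map_eq_of_card_lt_of_maps_to hcard hmaps
    have key : ∀ x y : ℕ, x / m = y / m → x < y → ((y - x : ℕ) : ℝ) ≤ 3 * Λ := by
      intro x y hd hlt
      have h1 := Nat.div_add_mod x m
      have h2 := Nat.div_add_mod y m
      have h3 := Nat.mod_lt y hmpos
      rw [hd] at h1
      have h4 : y - x + 1 ≤ m := by omega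
      have h5 : ((y - x : ℕ) : ℝ) + 1 ≤ m := by exact_mod_cast h4
      linarith
    rcases lt_or_gt_of_ne hxy with hlt | hlt
    · exact ⟨x, hx, y, hy, hlt, key x y hdiv hlt⟩
    · exact ⟨y, hy, x, hx, hlt, key y x hdiv.symm hlt⟩
  set q := h' - h with hq
  have hq0 : 0 < q := by omega
  have hqR : (0 : ℝ) < q := by exact_mod_cast hq0
  set a : ℤ := n h' - n h with ha
  refine ⟨q, hq0, hgap, a, ?_⟩
  set κ : ℝ := q * β - a with hκ
  have hqcast : (q : ℝ) = h' - h := by rw [hq, Nat.cast_sub hlt.le]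
  have hκε : |κ| ≤ 2 * ε := by
    have : κ = (h' * β - n h') - (h * β - n h) := by
      rw [hκ, hqcast, ha]; push_cast; ring
    rw [this]
    exact (abs_sub _ _).trans (by linarith [hn h hh, hn h' hh'])
  rcases eq_or_ne κ 0 with h0 | h0
  · rw [h0, abs_zero, zero_mul]; positivity
  have hκ0 : 0 < |κ| := abs_pos.2 h0
  -- With `n t` the integer next to `t β`, the integer `s t = q n_t - a t` is `t κ` up to `q ε`, so it
  -- takes few values, while elements of `T` with the same value differ by at most `2 q ε / |κ|`.
  set s : ℕ → ℤ := fun t => q * n t - a * t with hs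
  have hsdef : ∀ t : ℕ, (s t : ℝ) = t * κ - q * (t * β - n t) := by
    intro t; simp only [hs, hκ]; push_cast; ring
  have himg : ((T.image s).card : ℝ) ≤ 2 * (q * ε + K * |κ|) + 1 := by
    apply card_le_of_abs_le _ _ (by positivity)
    intro z hz
    obtain ⟨t, ht, rfl⟩ := Finset.mem_image.1 hz
    rw [hsdef]
    refine (abs_sub _ _).trans ?_
    rw [abs_mul, abs_mul, abs_of_pos hqR, Nat.abs_cast]
    have h1 : (t : ℝ) ≤ K := by exact_mod_cast (Finset.mem_range.1 (hT ht)).le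
    have h2 := hn t ht
    have h3 : (t : ℝ) * |κ| ≤ K * |κ| := by gcongr
    have h4 : (q : ℝ) * |t * β - n t| ≤ q * ε := by gcongr
    linarith
  have hfib : ∀ z ∈ T.image s, ((T.filter fun t => s t = z).card : ℝ) ≤ 2 * q * ε / |κ| + 1 := by
    intro z _
    apply card_le_of_sub_le _ _ (by positivity)
    intro t ht t' ht'
    rw [Finset.mem_filter] at ht ht'
    have h1 : ((t : ℝ) - t') * κ = q * (t * β - n t) - q * (t' * β - n t') := by
      have e1 := hsdef t
      have e2 := hsdef t'
      rw [ht.2] at e1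
      rw [ht'.2] at e2
      linarith
    rw [le_div_iff₀ hκ0]
    calc ((t : ℝ) - t') * |κ| ≤ |(t : ℝ) - t'| * |κ| := by gcongr; exact le_abs_self _
      _ = |q * (t * β - n t) - q * (t' * β - n t')| := by rw [← abs_mul, h1]
      _ ≤ q * |t * β - n t| + q * |t' * β - n t'| := by
          refine (abs_sub _ _).trans ?_
          rw [abs_mul, abs_mul, abs_of_pos hqR]
      _ ≤ q * ε + q * ε := by
          gcongr
          · exact hn t ht.1
          · exact hn t' ht'.1
      _ = 2 * q * ε := by ring
  have hq1 : (1 : ℝ) ≤ q := by exact_mod_cast hq0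
  have hcard : (T.card : ℝ) ≤ (2 * (q * ε + K * |κ|) + 1) * (2 * q * ε / |κ| + 1) := by
    rw [Finset.card_eq_sum_card_image s T]
    push_cast
    calc _ ≤ ∑ z ∈ T.image s, (2 * q * ε / |κ| + 1) := Finset.sum_le_sum hfib
      _ = (T.image s).card * (2 * q * ε / |κ| + 1) := by rw [Finset.sum_const, nsmul_eq_mul]
      _ ≤ _ := by gcongr
  have h1 : 1 ≤ 2 * q * ε / |κ| := by
    rw [le_div_iff₀ hκ0]; nlinarith
  have hqε : 2 * (q * ε) ≤ 1 := by nlinarith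
  have hmain : (T.card : ℝ) * |κ| ≤ (2 + 2 * K * |κ|) * (4 * q * ε) := by
    have h2 : (2 * (q * ε + K * |κ|) + 1) * (2 * q * ε / |κ| + 1)
        ≤ (2 + 2 * K * |κ|) * (2 * (2 * q * ε / |κ|)) :=
      mul_le_mul (by linarith) (by linarith) (by positivity) (by positivity)
    calc (T.card : ℝ) * |κ| ≤ (2 + 2 * K * |κ|) * (2 * (2 * q * ε / |κ|)) * |κ| := by
          gcongr; exact hcard.trans h2
      _ = _ := by field_simp; ring
  have h5 : (K : ℝ) * |κ| ≤ Λ * ((2 + 2 * K * |κ|) * (12 * Λ * ε)) := by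
    calc (K : ℝ) * |κ| ≤ Λ * T.card * |κ| := by gcongr
      _ = Λ * (T.card * |κ|) := by ring
      _ ≤ Λ * ((2 + 2 * K * |κ|) * (4 * q * ε)) := by gcongr
      _ ≤ Λ * ((2 + 2 * K * |κ|) * (12 * Λ * ε)) := by
          gcongr ?_ * (?_ * ?_)
          nlinarith
  have h6 : (K * |κ|) * (48 * Λ ^ 2 * ε) ≤ (K * |κ|) * 1 := by gcongr
  nlinarith

/-! ### Weyl's inequality -/

/-- The van der Corput inequality underlying Weyl differencing, with nonnegative
differences only. -/
theorem norm_sum_range_sq_le (a : ℕ → ℂ) (K : ℕ) :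
    ‖∑ z ∈ Finset.range K, a z‖ ^ 2 ≤
      2 * ∑ h ∈ Finset.range K,
        ‖∑ z ∈ Finset.range (K - h), a (z + h) * (starRingEnd ℂ) (a z)‖ := by
  have h1 : ‖∑ z ∈ Finset.range K, a z‖ ^ 2 ≤
      2 * (∑ m ∈ Finset.range K, ∑ j ∈ Finset.range (m + 1), a m * (starRingEnd ℂ) (a j)).re := by
    induction K with
    | zero => simp
    | succ K ih =>
      rw [Finset.sum_range_succ, Finset.sum_range_succ (fun m => ∑ j ∈ Finset.range (m + 1), _) K,
        Complex.add_re, Finset.sum_range_succ _ K, ← Finset.mul_sum, ← map_sum]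
      set S := ∑ z ∈ Finset.range K, a z
      have : ‖S + a K‖ ^ 2 = ‖S‖ ^ 2 + ‖a K‖ ^ 2 + 2 * (a K * (starRingEnd ℂ) S).re := by
        simp only [← Complex.normSq_eq_norm_sq, Complex.normSq_add]
        congr 2
        simp; ring
      rw [this, Complex.add_re]
      have h2 : (a K * (starRingEnd ℂ) (a K)).re = ‖a K‖ ^ 2 := by
        rw [Complex.mul_conj, Complex.ofReal_re, Complex.normSq_eq_norm_sq]
      rw [h2]
      nlinarith [sq_nonneg ‖a K‖]
  have h2 : ∑ m ∈ Finset.range K, ∑ j ∈ Finset.range (m + 1), a m * (starRingEnd ℂ) (a j)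
      = ∑ h ∈ Finset.range K, ∑ z ∈ Finset.range (K - h), a (z + h) * (starRingEnd ℂ) (a z) := by
    rw [← Finset.sum_range_diag_flip K fun h z => a (z + h) * (starRingEnd ℂ) (a z)]
    refine Finset.sum_congr rfl fun m _ => ?_
    rw [← Finset.sum_range_reflect]
    refine Finset.sum_congr rfl fun j hj => ?_
    have := Finset.mem_range.1 hj
    rw [show m - j + j = m by omega, show m + 1 - 1 - j = m - j by omega]
  rw [h2] at h1
  refine h1.trans ?_
  gcongr
  exact (Complex.re_le_norm _).trans (norm_sum_le _ _)

theorem natDegree_shift_sub_le (p : ℝ[X]) (d : ℕ) (hp : p.natDegree ≤ d + 1) (h : ℝ) :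
    (p.comp (X + C h) - p).natDegree ≤ d := by
  rw [natDegree_le_iff_coeff_eq_zero]
  intro i hi
  have h1 : (p.comp (X + C h)) = taylor h p := (taylor_apply h p).symm
  rw [coeff_sub, h1, taylor_coeff]
  rcases eq_or_lt_of_le (Nat.succ_le_of_lt hi) with h2 | h2
  · have h3 : (hasseDeriv i p).natDegree ≤ 0 := by
      refine (natDegree_hasseDeriv_le p i).trans ?_
      omega
    rw [eq_C_of_natDegree_le_zero h3, eval_C, hasseDeriv_coeff]
    simp
  · have h3 : p.natDegree < i := by omega
    rw [hasseDeriv_eq_zero_of_lt_natDegree _ _ h3, coeff_eq_zero_of_natDegree_lt h3]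
    simp

theorem coeff_shift_sub (p : ℝ[X]) (d : ℕ) (hp : p.natDegree ≤ d + 1) (h : ℝ) :
    (p.comp (X + C h) - p).coeff d = (d + 1) * h * p.coeff (d + 1) := by
  have h1 : (p.comp (X + C h)) = taylor h p := (taylor_apply h p).symm
  rw [coeff_sub, h1, taylor_coeff]
  have h3 : (hasseDeriv d p).natDegree ≤ 1 := by
    refine (natDegree_hasseDeriv_le p d).trans ?_
    omega
  rw [eq_X_add_C_of_natDegree_le_one h3]
  simp [hasseDeriv_coeff]
  rw [add_comm 1 d, Nat.choose_succ_self_right]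
  push_cast
  ring

theorem norm_geom_sum_e_le (α : ℝ) (a : ℤ) (K : ℕ) (h : |α - a| ≤ 1 / 2) :
    |α - a| * ‖∑ z ∈ Finset.range K, e (α * z)‖ ≤ 1 / 2 := by
  have h1 : ∀ z : ℕ, e (α * z) = e α ^ z := by
    intro z
    induction z with
    | zero => simp
    | succ k ih => rw [pow_succ, ← ih, ← e_add]; congr 1; push_cast; ring
  have h2 : (∑ z ∈ Finset.range K, e (α * z)) * (e α - 1) = e α ^ K - 1 := by
    simp_rw [h1]
    exact geom_sum_mul _ _
  have h3 := congrArg norm h2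
  rw [norm_mul] at h3
  have h4 : ‖e α ^ K - 1‖ ≤ 2 := by
    refine (norm_sub_le _ _).trans ?_
    rw [norm_pow, norm_e]; norm_num
  have h5 := four_mul_le_norm_e_sub_one α a h
  nlinarith [norm_nonneg (∑ z ∈ Finset.range K, e (α * z))]

/-- Weyl's inequality, with a loss that is polynomial in `Λ` alone: if an exponential sum of length
`K` over a real polynomial of degree at most `d + 1` is at least `K / Λ`, then the leading
coefficient has a multiple by some `q = Λ^{O(1)}` within `Λ^{O(1)} / K^{d + 1}` of an integer. -/
theorem weyl_inequality (d : ℕ) : ∃ F : ℝ → ℝ, PolyGrowth F ∧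
    ∀ (p : ℝ[X]) (K : ℕ) (Λ : ℝ), p.natDegree ≤ d + 1 → 0 < K → 1 ≤ Λ →
      (K : ℝ) ≤ Λ * ‖∑ z ∈ Finset.range K, e (p.eval (z : ℝ))‖ →
      ∃ q : ℕ, 0 < q ∧ (q : ℝ) ≤ F Λ ∧
        ∃ a : ℤ, |q * p.coeff (d + 1) - a| * (K : ℝ) ^ (d + 1) ≤ F Λ := by
  induction d with
  | zero =>
    refine ⟨fun t => t, PolyGrowth.self, ?_⟩
    intro p K Λ hp hK hΛ hS
    refine ⟨1, one_pos, by simpa using hΛ, round (p.coeff 1), ?_⟩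
    have hr := abs_sub_round (p.coeff 1)
    have h1 := norm_geom_sum_e_le (p.coeff 1) _ K hr
    have h2 : ‖∑ z ∈ Finset.range K, e (p.eval (z : ℝ))‖
        = ‖∑ z ∈ Finset.range K, e (p.coeff 1 * z)‖ := by
      rw [← one_mul ‖∑ z ∈ Finset.range K, e (p.coeff 1 * z)‖, ← norm_e (p.coeff 0), ← norm_mul,
        Finset.mul_sum]
      congr 1
      refine Finset.sum_congr rfl fun z _ => ?_
      rw [← e_add]
      congr 1
      conv_lhs => rw [eq_X_add_C_of_natDegree_le_one hp]
      simp; ring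
    rw [h2] at hS
    simp only [zero_add, Nat.cast_one, one_mul, pow_one]
    have h3 : |p.coeff 1 - round (p.coeff 1)| * K ≤ |p.coeff 1 - round (p.coeff 1)| *
        (Λ * ‖∑ z ∈ Finset.range K, e (p.coeff 1 * z)‖) := by gcongr
    nlinarith
  | succ d ih =>
    obtain ⟨F, ⟨c, hc⟩, hF⟩ := ih
    -- the parameters of the inductive step, all of polynomial growth in `Λ`
    set Q : ℝ → ℝ := fun Λ => c * (8 * Λ ^ 2) ^ c with hQ
    set E : ℝ → ℝ := fun Λ => Q Λ * (8 * Λ ^ 2) ^ (d + 1) with hE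
    set M : ℝ → ℝ := fun Λ => 4 * Λ ^ 2 * Q Λ with hM
    set B : ℝ → ℝ := fun Λ => 48 * M Λ ^ 2 * E Λ + (2 * M Λ + 8 * Λ ^ 2) with hB
    have pQ : PolyGrowth Q := (PolyGrowth.const c.cast_nonneg).mul
      (((PolyGrowth.const (by norm_num)).mul (PolyGrowth.self.pow 2)).pow c)
    have pE : PolyGrowth E :=
      pQ.mul (((PolyGrowth.const (by norm_num)).mul (PolyGrowth.self.pow 2)).pow (d + 1))
    have pM : PolyGrowth M :=
      ((PolyGrowth.const (by norm_num)).mul (PolyGrowth.self.pow 2)).mul pQ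
    have p48 : PolyGrowth fun t => 48 * M t ^ 2 * E t :=
      ((PolyGrowth.const (by norm_num)).mul (pM.pow 2)).mul pE
    have pB : PolyGrowth B :=
      p48.add (((PolyGrowth.const (by norm_num)).mul pM).add
        ((PolyGrowth.const (by norm_num)).mul (PolyGrowth.self.pow 2)))
    have pM' : PolyGrowth fun t => 3 * M t * (Q t * (d + 2)) :=
      ((PolyGrowth.const (by norm_num)).mul pM).mul (pQ.mul (PolyGrowth.const (by positivity)))
    refine ⟨fun t => 3 * M t * (Q t * (d + 2)) + 48 * M t ^ 2 * E t + (B t ^ (d + 2) + 1),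
      (pM'.add p48).add ((pB.pow _).add (PolyGrowth.const zero_le_one)), ?_⟩
    intro p K Λ hp hK hΛ hS
    obtain ⟨_, gQ⟩ := pQ
    obtain ⟨_, gE⟩ := pE
    obtain ⟨_, gM⟩ := pM
    obtain ⟨_, gB⟩ := pB
    replace gQ := (gQ Λ hΛ).1
    replace gE := (gE Λ hΛ).1
    replace gM := (gM Λ hΛ).1
    replace gB := (gB Λ hΛ).1
    have hK1 : (1 : ℝ) ≤ K := by exact_mod_cast hK
    by_cases hsmall : (K : ℝ) ≤ B Λ
    · -- `K` is so small that `q = 1` works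
      refine ⟨1, one_pos, ?_, round (p.coeff (d + 1 + 1)), ?_⟩
      · have : 0 ≤ 3 * M Λ * (Q Λ * (d + 2)) + 48 * M Λ ^ 2 * E Λ + B Λ ^ (d + 2) := by positivity
        push_cast
        linarith
      · have h1 := abs_sub_round (p.coeff (d + 1 + 1))
        have h2 : (K : ℝ) ^ (d + 2) ≤ B Λ ^ (d + 2) := by gcongr
        have h3 : 0 ≤ 3 * M Λ * (Q Λ * (d + 2)) + 48 * M Λ ^ 2 * E Λ := by positivity
        rw [Nat.cast_one, one_mul]
        have h4 : |p.coeff (d + 1 + 1) - round (p.coeff (d + 1 + 1))| * (K : ℝ) ^ (d + 1 + 1)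
            ≤ 1 * (K : ℝ) ^ (d + 2) := by gcongr; linarith
        linarith
    push Not at hsmall
    have hL2 : 0 < Λ ^ 2 := by positivity
    set D : ℕ → ℝ := fun h => ‖∑ z ∈ Finset.range (K - h), e (p.eval ((z + h : ℕ) : ℝ)) *
      (starRingEnd ℂ) (e (p.eval (z : ℝ)))‖ with hD
    have hD_le : ∀ h, D h ≤ (K - h : ℕ) := by
      intro h
      refine (norm_sum_le _ _).trans ?_
      simp
    have hdiff : (K : ℝ) ^ 2 ≤ Λ ^ 2 * (2 * ∑ h ∈ Finset.range K, D h) := by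
      calc (K : ℝ) ^ 2 ≤ (Λ * ‖∑ z ∈ Finset.range K, e (p.eval (z : ℝ))‖) ^ 2 := by gcongr
        _ = Λ ^ 2 * ‖∑ z ∈ Finset.range K, e (p.eval (z : ℝ))‖ ^ 2 := by ring
        _ ≤ _ := by
          gcongr
          exact norm_sum_range_sq_le (fun z => e (p.eval (z : ℝ))) K
    -- many differences `h` have a large differenced sum
    set T := (Finset.range K).filter fun h => (K : ℝ) ≤ 8 * Λ ^ 2 * D h with hT
    have hTcard : (K : ℝ) ≤ 4 * Λ ^ 2 * T.card := by
      have h1 : ∑ h ∈ Finset.range K, D h ≤ T.card * K + K * (K / (8 * Λ ^ 2)) := by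
        rw [← Finset.sum_filter_add_sum_filter_not _ fun h => (K : ℝ) ≤ 8 * Λ ^ 2 * D h]
        gcongr
        · rw [← nsmul_eq_mul]
          refine Finset.sum_le_card_nsmul _ _ _ fun h _ => ?_
          refine (hD_le h).trans ?_
          exact_mod_cast Nat.sub_le _ _
        · calc _ ≤ ((Finset.range K).filter fun h => ¬ (K : ℝ) ≤ 8 * Λ ^ 2 * D h).card •
                ((K : ℝ) / (8 * Λ ^ 2)) := by
                refine Finset.sum_le_card_nsmul _ _ _ fun h hh => ?_
                rw [Finset.mem_filter] at hh
                rw [le_div_iff₀ (by positivity)]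
                linarith [not_le.1 hh.2]
            _ ≤ _ := by
                rw [nsmul_eq_mul]
                gcongr
                exact_mod_cast (Finset.card_filter_le _ _).trans (by simp)
      have h2 : (K : ℝ) ^ 2 ≤ K * (2 * Λ ^ 2 * T.card + K / 4) := by
        calc (K : ℝ) ^ 2 ≤ Λ ^ 2 * (2 * (T.card * K + K * (K / (8 * Λ ^ 2)))) := by
              refine hdiff.trans ?_
              gcongr
          _ = _ := by field_simp; ring
      have h3 : (K : ℝ) ≤ 2 * Λ ^ 2 * T.card + K / 4 := by
        rw [sq] at h2
        exact le_of_mul_le_mul_left h2 (by linarith)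
      have : 0 ≤ Λ ^ 2 * T.card := by positivity
      linarith
    have hih : ∀ h ∈ T, ∃ q : ℕ, 0 < q ∧ (q : ℝ) ≤ Q Λ ∧
        ∃ a : ℤ, |q * ((d + 2) * h * p.coeff (d + 2)) - a| * (K : ℝ) ^ (d + 1) ≤ E Λ := by
      intro h hh
      rw [hT, Finset.mem_filter, Finset.mem_range] at hh
      have hpos : 0 < K - h := by omega
      have hKD : (K : ℝ) ≤ 8 * Λ ^ 2 * (K - h : ℕ) := by
        refine hh.2.trans ?_
        gcongr
        exact hD_le h
      have h8 : 1 ≤ 8 * Λ ^ 2 := by nlinarith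
      have hFle : F (8 * Λ ^ 2) ≤ Q Λ := (hc _ h8).2
      obtain ⟨q, hq0, hq1, a, ha⟩ := hF (p.comp (X + C (h : ℝ)) - p) (K - h) (8 * Λ ^ 2)
        (natDegree_shift_sub_le p (d + 1) hp h) hpos h8 (by
          calc ((K - h : ℕ) : ℝ) ≤ K := by exact_mod_cast Nat.sub_le _ _
            _ ≤ _ := hh.2
            _ = _ := by
              simp only [hD, ← e_sub, eval_sub, eval_comp, eval_add, eval_X, eval_C,
                Nat.cast_add])
      refine ⟨q, hq0, hq1.trans hFle, a, ?_⟩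
      rw [coeff_shift_sub p (d + 1) hp] at ha
      have h9 : (((d + 1 : ℕ) : ℝ) + 1) = d + 2 := by push_cast; ring
      rw [h9] at ha
      calc _ ≤ |q * ((d + 2) * h * p.coeff (d + 2)) - a| *
            ((8 * Λ ^ 2) * (K - h : ℕ)) ^ (d + 1) := by gcongr
        _ = (|q * ((d + 2) * h * p.coeff (d + 2)) - a| * ((K - h : ℕ) : ℝ) ^ (d + 1)) *
            (8 * Λ ^ 2) ^ (d + 1) := by rw [mul_pow]; ring
        _ ≤ E Λ := by
            rw [hE]
            have := ha.trans hFle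
            simp only
            gcongr
    choose! qf hq0 hq1 hqa using hih
    -- a single denominator serves many of them
    have hmaps : ∀ h ∈ T, qf h ∈ Finset.Icc 1 ⌊Q Λ⌋₊ := fun h hh =>
      Finset.mem_Icc.2 ⟨hq0 h hh, Nat.le_floor (hq1 h hh)⟩
    obtain ⟨q, hqmem, hqcard⟩ : ∃ q ∈ Finset.Icc 1 ⌊Q Λ⌋₊,
        (T.card : ℝ) ≤ Q Λ * (T.filter fun h => qf h = q).card := by
      by_contra! hcon
      have hTpos : T.Nonempty := by
        rw [← Finset.card_pos]
        have h1 : (0 : ℝ) < 4 * Λ ^ 2 * T.card := by linarith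
        have h2 : (0 : ℝ) < T.card := by
          by_contra h
          have : (T.card : ℝ) = 0 := le_antisymm (not_lt.1 h) (Nat.cast_nonneg _)
          rw [this] at h1; simp at h1
        exact_mod_cast h2
      have hne : (Finset.Icc 1 ⌊Q Λ⌋₊).Nonempty := ⟨_, hmaps _ hTpos.choose_spec⟩
      have h1 : (T.card : ℝ) = ∑ q ∈ Finset.Icc 1 ⌊Q Λ⌋₊,
          ((T.filter fun h => qf h = q).card : ℝ) := by
        exact_mod_cast Finset.card_eq_sum_card_fiberwise hmaps
      have h2 : Q Λ * T.card < ∑ q ∈ Finset.Icc 1 ⌊Q Λ⌋₊, (T.card : ℝ) := by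
        rw [h1, Finset.mul_sum, ← h1]
        exact Finset.sum_lt_sum_of_nonempty hne hcon
      rw [Finset.sum_const, nsmul_eq_mul, Nat.card_Icc, Nat.add_sub_cancel] at h2
      have h3 := Nat.floor_le gQ
      have h4 : (⌊Q Λ⌋₊ : ℝ) * T.card ≤ Q Λ * T.card := by gcongr
      linarith
    rw [Finset.mem_Icc] at hqmem
    have hq1' : (q : ℝ) ≤ Q Λ := (Nat.cast_le.2 hqmem.2).trans (Nat.floor_le gQ)
    have hqR : (1 : ℝ) ≤ q := by exact_mod_cast hqmem.1
    set T' := T.filter fun h => qf h = q with hT'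
    have hKpow : (0 : ℝ) < (K : ℝ) ^ (d + 1) := by positivity
    have hM1 : 1 ≤ M Λ := by rw [hM]; nlinarith
    have h48 : 0 ≤ 48 * M Λ ^ 2 * E Λ := by positivity
    have hKself : (K : ℝ) ≤ (K : ℝ) ^ (d + 1) := le_self_pow₀ hK1 (by omega)
    obtain ⟨q', hq'0, hq'1, a, ha⟩ := exists_approx_of_recurrent (q * (d + 2) * p.coeff (d + 2))
      (E Λ / (K : ℝ) ^ (d + 1)) (M Λ) K T' hM1 (by positivity)
      (by
        rw [mul_div_assoc', div_le_one hKpow]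
        have : 0 ≤ 2 * M Λ + 8 * Λ ^ 2 := by positivity
        simp only [hB] at hsmall
        linarith)
      ((Finset.filter_subset _ _).trans (Finset.filter_subset _ _))
      (by
        calc (K : ℝ) ≤ 4 * Λ ^ 2 * T.card := hTcard
          _ ≤ 4 * Λ ^ 2 * (Q Λ * T'.card) := by gcongr
          _ = M Λ * T'.card := by simp only [hM]; ring)
      (by simp only [hB] at hsmall; nlinarith)
      (by
        intro h hh
        rw [hT', Finset.mem_filter] at hh
        obtain ⟨a, ha⟩ := hqa h hh.1
        refine ⟨a, ?_⟩
        rw [hh.2] at ha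
        rw [le_div_iff₀ hKpow]
        calc _ = |q * ((d + 2) * h * p.coeff (d + 2)) - a| * (K : ℝ) ^ (d + 1) := by ring_nf
          _ ≤ _ := ha)
    have hBpos : 0 ≤ B Λ ^ (d + 2) := by positivity
    refine ⟨q' * (q * (d + 2)), by have := hqmem.1; positivity, ?_, a, ?_⟩
    · have : ((q' * (q * (d + 2)) : ℕ) : ℝ) ≤ 3 * M Λ * (Q Λ * (d + 2)) := by
        push_cast; gcongr
      linarith
    · have h1 : 0 ≤ 3 * M Λ * (Q Λ * (d + 2)) := by positivity
      have h2 : |((q' * (q * (d + 2)) : ℕ) : ℝ) * p.coeff (d + 1 + 1) - a| * (K : ℝ) ^ (d + 1 + 1)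
          ≤ 48 * M Λ ^ 2 * E Λ := by
        calc _ = (|q' * (q * (d + 2) * p.coeff (d + 2)) - a| * K) * (K : ℝ) ^ (d + 1) := by
              push_cast; ring_nf
          _ ≤ (48 * M Λ ^ 2 * (E Λ / (K : ℝ) ^ (d + 1))) * (K : ℝ) ^ (d + 1) := by gcongr
          _ = _ := by field_simp
      linarith

/-! ### Complete exponential sums and rational approximation -/

theorem sum_range_add_of_periodic (F : ℕ → ℂ) (n m : ℕ) (hF : ∀ s, F (s + n) = F s) :
    ∑ s ∈ Finset.range n, F (s + m) = ∑ s ∈ Finset.range n, F s := by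
  induction m with
  | zero => simp
  | succ m ih =>
    rw [← ih]
    have h1 := Finset.sum_range_succ (fun s => F (s + m)) n
    have h2 := Finset.sum_range_succ' (fun s => F (s + m)) n
    have h3 : F (n + m) = F (0 + m) := by rw [add_comm, hF, zero_add]
    have h4 : ∀ s, F (s + 1 + m) = F (s + (m + 1)) := fun s => by congr 1; ring
    simp only [h4] at h2
    rw [h1, h3] at h2
    exact (add_right_cancel h2).symm

theorem e_eq_of_sub_eq_intCast {x y : ℝ} (n : ℤ) (h : x - y = n) : e x = e y := by
  rw [← sub_add_cancel x y, e_add, h, e_intCast, one_mul]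

theorem ratCast_mul_eq_intCast (x : ℚ) (n : ℤ) (h : (x.den : ℤ) ∣ n) :
    ∃ k : ℤ, (x : ℝ) * n = k := by
  obtain ⟨c, rfl⟩ := h
  refine ⟨x.num * c, ?_⟩
  have h1 : (x : ℝ) * x.den = x.num := by exact_mod_cast Rat.mul_den_eq_num x
  push_cast
  rw [← mul_assoc, h1]

theorem e_rat_periodic (Q : ℤ[X]) (x : ℚ) (s : ℕ) :
    e (x * (Q.eval ((s + x.den : ℕ) : ℤ) : ℤ)) = e (x * (Q.eval (s : ℤ) : ℤ)) := by
  have h1 : (x.den : ℤ) ∣ Q.eval ((s + x.den : ℕ) : ℤ) - Q.eval (s : ℤ) := by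
    refine dvd_trans ?_ (sub_dvd_eval_sub _ _ Q)
    simp
  obtain ⟨k, hk⟩ := ratCast_mul_eq_intCast x _ h1
  refine e_eq_of_sub_eq_intCast k ?_
  rw [← hk]; push_cast; ring

/-- A complete sum of `e(x Q(s))` over the residues modulo the denominator of `x` vanishes when
`Q ≡ X` modulo a number that has a prime factor `p` in common with this denominator. Indeed, the
shift `s ↦ s + m`, with `m` the denominator divided by `p`, multiplies the sum by `e(x m) ≠ 1`. -/
theorem sum_e_rat_eq_zero (Q G : ℤ[X]) (W : ℤ) (hQ : Q = X + C W * G) (x : ℚ) (p : ℕ)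
    (hp : p.Prime) (hpx : p ∣ x.den) (hpW : (p : ℤ) ∣ W) :
    ∑ s ∈ Finset.range x.den, e (x * (Q.eval (s : ℤ) : ℤ)) = 0 := by
  obtain ⟨m, hm⟩ := hpx
  have hshift := sum_range_add_of_periodic (fun s => e (x * (Q.eval (s : ℤ) : ℤ))) x.den m
    (e_rat_periodic Q x)
  have hfac : ∀ s : ℕ, e (x * (Q.eval ((s + m : ℕ) : ℤ) : ℤ)) =
      e (x * (Q.eval (s : ℤ) : ℤ)) * e (x * m) := by
    intro s
    rw [← e_add]
    have h1 : (x.den : ℤ) ∣ W * (G.eval ((s + m : ℕ) : ℤ) - G.eval (s : ℤ)) := by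
      rw [hm, Nat.cast_mul]
      refine mul_dvd_mul hpW (dvd_trans ?_ (sub_dvd_eval_sub _ _ G))
      simp
    obtain ⟨k, hk⟩ := ratCast_mul_eq_intCast x _ h1
    refine e_eq_of_sub_eq_intCast k ?_
    rw [← hk, hQ]
    simp only [eval_add, eval_mul, eval_X, eval_C]
    push_cast
    ring
  have hne : e (x * m) ≠ 1 := by
    intro h
    unfold e at h
    rw [Complex.exp_eq_one_iff] at h
    obtain ⟨n, hn⟩ := h
    have h2 : ((2 * Real.pi * (x * m) : ℝ) : ℂ) = ((2 * Real.pi * n : ℝ) : ℂ) := by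
      have : ((2 * Real.pi * (x * m) : ℝ) : ℂ) * Complex.I
          = ((2 * Real.pi * n : ℝ) : ℂ) * Complex.I := by
        rw [hn]; push_cast; ring
      exact mul_right_cancel₀ Complex.I_ne_zero this
    have h3 : (x : ℝ) * m = n := mul_left_cancel₀ Real.two_pi_pos.ne' (by exact_mod_cast h2)
    have h4 : (x : ℝ) * x.den = x.num := by exact_mod_cast Rat.mul_den_eq_num x
    have h5 : (x.num : ℝ) = p * n := by
      rw [← h4, hm, ← h3]; push_cast; ring
    have h6 : x.num = p * n := by exact_mod_cast h5
    have h7 : p ∣ x.num.natAbs := by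
      rw [h6, Int.natAbs_mul, Int.natAbs_natCast]; exact dvd_mul_right _ _
    have h8 := Nat.Coprime.eq_one_of_dvd (Nat.Coprime.coprime_dvd_left h7 x.reduced)
      (hm ▸ dvd_mul_right p m)
    exact hp.one_lt.ne' h8
  simp only [hfac] at hshift
  rw [← Finset.sum_mul] at hshift
  by_contra h0
  exact hne (mul_left_cancel₀ h0 (hshift.trans (mul_one _).symm))

theorem norm_sum_range_mul_le (g : ℕ → ℂ) (n M : ℕ) (c : ℝ)
    (h : ∀ i < M, ‖∑ s ∈ Finset.range n, g (n * i + s)‖ ≤ c) :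
    ‖∑ z ∈ Finset.range (n * M), g z‖ ≤ M * c := by
  induction M with
  | zero => simp
  | succ M ih =>
    rw [Nat.mul_succ, Finset.sum_range_add]
    refine (norm_add_le _ _).trans ?_
    have h1 := ih fun i hi => h i (by omega)
    have h2 := h M (by omega)
    push_cast
    linarith

/-- If the sum of `e(α Q(z))` over `z < K` is at least `K / Λ`, where `Q ≡ X` modulo `W` and the
leading coefficient of `Q` is a power of `W` up to the bounded factors `b` and `b'`, then `α` is
close to a rational number whose denominator is bounded in terms of `Λ` and `b'` only. -/
theorem exists_approx_of_large_sum (d : ℕ) : ∃ F : ℝ → ℝ, PolyGrowth F ∧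
    ∀ (Q G : ℤ[X]) (W k : ℕ) (b b' : ℤ) (α H Λ : ℝ) (K : ℕ), Q = X + C (W : ℤ) * G →
      Q.natDegree = d + 1 → b' ≠ 0 → Q.leadingCoeff * b = b' * (W : ℤ) ^ k → 0 < K → 1 ≤ Λ →
      0 ≤ H → (∀ z z' : ℕ, z < K → z' < K →
        |((Q.eval (z : ℤ) : ℤ) : ℝ) - (Q.eval (z' : ℤ) : ℤ)| ≤ H * |(z : ℝ) - z'| * (K : ℝ) ^ d) →
      Λ * (F Λ * |(Q.leadingCoeff : ℝ)| * (7 * F Λ * H + 1)) < K →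
      (K : ℝ) ≤ Λ * ‖∑ z ∈ Finset.range K, e (α * (Q.eval (z : ℤ) : ℤ))‖ →
      ∃ q : ℕ, 0 < q ∧ (q : ℝ) ≤ F Λ * |(b' : ℝ)| ∧
        ∃ a : ℤ, |q * α - a| * ((K : ℝ) ^ (d + 1) * |(Q.leadingCoeff : ℝ)|) ≤ F Λ * |(b' : ℝ)| := by
  obtain ⟨F, hFg, hF⟩ := weyl_inequality d
  refine ⟨F, hFg, ?_⟩
  obtain ⟨_, hF0⟩ := hFg
  intro Q G W k b b' α H Λ K hQ hd hb' hL hK hΛ hH hlip hbig hS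
  replace hF0 := (hF0 Λ hΛ).1
  set L := Q.leadingCoeff with hLdef
  have hL0 : L ≠ 0 := by
    rw [hLdef, Ne, leadingCoeff_eq_zero]
    rintro h0
    rw [h0, natDegree_zero] at hd
    omega
  have hLR : (1 : ℝ) ≤ |(L : ℝ)| := by exact_mod_cast Int.one_le_abs hL0
  have hKR : (1 : ℝ) ≤ K := by exact_mod_cast hK
  obtain ⟨q, hq0, hq1, a, ha⟩ := hF (C α * Q.map (Int.castRingHom ℝ)) K Λ
    ((natDegree_C_mul_le _ _).trans (natDegree_map_le.trans hd.le)) hK hΛ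
    (by
      refine hS.trans_eq ?_
      congr 2
      refine Finset.sum_congr rfl fun z _ => ?_
      congr 1
      rw [eval_mul, eval_C]
      congr 1
      have := eval_intCast_map (Int.castRingHom ℝ) Q (z : ℤ)
      rw [Int.cast_natCast] at this
      rw [this]; simp)
  rw [coeff_C_mul, coeff_map, ← hd, coeff_natDegree, hd, ← hLdef, eq_intCast] at ha
  -- the rational number `a / (q L)` in lowest terms
  set x : ℚ := (a : ℚ) / ((q * L : ℤ) : ℚ) with hx
  have hqR : (1 : ℝ) ≤ q := by exact_mod_cast hq0
  have hqL : (q * L : ℤ) ≠ 0 := mul_ne_zero (by exact_mod_cast hq0.ne') hL0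
  have hden : (x.den : ℤ) ∣ q * L := by
    rw [hx, ← Rat.divInt_eq_div]; exact Rat.den_dvd _ _
  have hxR : (x : ℝ) * (q * L) = a := by
    have h1 : ((q * L : ℤ) : ℝ) ≠ 0 := by exact_mod_cast hqL
    rw [hx]
    push_cast at h1 ⊢
    field_simp
  set θ : ℝ := α - x with hθ
  have hθ1 : |θ| * (q * |(L : ℝ)|) * (K : ℝ) ^ (d + 1) ≤ F Λ := by
    have h1 : q * (α * L) - a = θ * (q * L) := by
      rw [hθ, sub_mul, hxR]; ring
    rw [h1, abs_mul, abs_mul, Nat.abs_cast] at ha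
    exact ha
  have hxden : (0 : ℝ) < x.den := by exact_mod_cast x.den_pos
  have hdenle : (x.den : ℝ) ≤ q * |(L : ℝ)| := by
    have h1 := Int.le_of_dvd (abs_pos.2 hqL) ((dvd_abs _ _).2 hden)
    rw [abs_mul, Nat.abs_cast] at h1
    exact_mod_cast h1
  -- the denominator is coprime to `W`, as otherwise the complete sums vanish
  have hcop : x.den.Coprime W := by
    by_contra hnc
    obtain ⟨p, hp, hpx, hpW⟩ := Nat.Prime.not_coprime_iff_dvd.1 hnc
    have hzero := sum_e_rat_eq_zero Q G W hQ x p hp hpx (by exact_mod_cast hpW)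
    set n := x.den with hn
    set g : ℕ → ℂ := fun z => e (α * (Q.eval (z : ℤ) : ℤ)) with hg
    -- On a block of length `n` the factor `e(θ Q)` is nearly constant, and the rest sums to
    -- zero as a complete sum.
    have hper : ∀ i s : ℕ, e (x * (Q.eval ((n * i + s : ℕ) : ℤ) : ℤ)) =
        e (x * (Q.eval (s : ℤ) : ℤ)) := by
      intro i s
      induction i with
      | zero => simp
      | succ i ih =>
        rw [← ih, ← e_rat_periodic Q x (n * i + s)]
        congr 5
        rw [← hn]; ring
    have hblock : ∀ i < K / n, ‖∑ s ∈ Finset.range n, g (n * i + s)‖ ≤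
        n * (7 * |θ| * H * n * (K : ℝ) ^ d) := by
      intro i hi
      have hlt : ∀ s < n, n * i + s < K := by
        intro s hs
        have h1 : n * (i + 1) ≤ n * (K / n) := Nat.mul_le_mul_left _ hi
        have h2 := Nat.mul_div_le K n
        rw [Nat.mul_succ] at h1
        omega
      have h1 : ∑ s ∈ Finset.range n, g (n * i + s) = ∑ s ∈ Finset.range n,
          e (x * (Q.eval (s : ℤ) : ℤ)) * (e (θ * (Q.eval ((n * i + s : ℕ) : ℤ) : ℤ)) -
            e (θ * (Q.eval ((n * i : ℕ) : ℤ) : ℤ))) := by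
        simp only [mul_sub, Finset.sum_sub_distrib]
        rw [← Finset.sum_mul, hzero, zero_mul, sub_zero]
        refine Finset.sum_congr rfl fun s _ => ?_
        rw [← hper i s, ← e_add, hg, hθ]
        simp only
        congr 1
        ring
      rw [h1]
      refine (norm_sum_le _ _).trans ?_
      rw [← nsmul_eq_mul]
      refine (Finset.sum_le_card_nsmul _ _ (7 * |θ| * H * n * (K : ℝ) ^ d) fun s hs => ?_).trans
        (by rw [Finset.card_range])
      have hs' := Finset.mem_range.1 hs
      rw [norm_mul, norm_e, one_mul]
      refine (norm_e_sub_e_le _ _).trans ?_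
      rw [← mul_sub, abs_mul]
      have h2 := hlip (n * i + s) (n * i) (hlt s hs') (by have := hlt s hs'; omega)
      have h3 : |((n * i + s : ℕ) : ℝ) - ((n * i : ℕ) : ℝ)| ≤ n := by
        push_cast
        rw [add_sub_cancel_left, Nat.abs_cast]
        exact_mod_cast hs'.le
      calc 2 * Real.pi * (|θ| * _) ≤ 7 * (|θ| * (H * n * (K : ℝ) ^ d)) := by
            gcongr
            · linarith [Real.pi_lt_d2]
            · refine h2.trans ?_
              gcongr
        _ = _ := by ring
    have h1 := norm_sum_range_mul_le g n (K / n) _ hblock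
    have h2 : ‖∑ z ∈ Finset.range K, g z‖ ≤
        (K / n : ℕ) * (n * (7 * |θ| * H * n * (K : ℝ) ^ d)) + n := by
      have h3 : K = n * (K / n) + K % n := (Nat.div_add_mod K n).symm
      have h4 : ‖∑ s ∈ Finset.range (K % n), g (n * (K / n) + s)‖ ≤ n := by
        refine (norm_sum_le _ _).trans ?_
        simp only [hg, norm_e, Finset.sum_const, Finset.card_range, nsmul_eq_mul, mul_one]
        exact_mod_cast (Nat.mod_lt K x.den_pos).le
      conv_lhs => rw [h3]
      rw [Finset.sum_range_add]
      exact (norm_add_le _ _).trans (add_le_add h1 h4)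
    have h5 : ((K / n : ℕ) : ℝ) * n ≤ K := by exact_mod_cast Nat.div_mul_le_self K n
    have hnle : (n : ℝ) ≤ F Λ * |(L : ℝ)| := hdenle.trans (by gcongr)
    have h6 : |θ| * (K : ℝ) ^ (d + 1) ≤ F Λ := by
      refine le_trans ?_ hθ1
      have : 1 ≤ q * |(L : ℝ)| := by nlinarith
      have h7 : 0 ≤ |θ| * (K : ℝ) ^ (d + 1) := by positivity
      nlinarith
    have h7 : ‖∑ z ∈ Finset.range K, g z‖ ≤ F Λ * |(L : ℝ)| * (7 * F Λ * H + 1) := by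
      calc _ ≤ ((K / n : ℕ) : ℝ) * n * (7 * |θ| * H * n * (K : ℝ) ^ d) + n := by linarith
        _ ≤ K * (7 * |θ| * H * n * (K : ℝ) ^ d) + n := by gcongr
        _ = 7 * (|θ| * (K : ℝ) ^ (d + 1)) * H * n + n := by ring
        _ ≤ 7 * F Λ * H * n + n := by gcongr
        _ = n * (7 * F Λ * H + 1) := by ring
        _ ≤ _ := by gcongr
    have h8 : Λ * ‖∑ z ∈ Finset.range K, g z‖ ≤ Λ * (F Λ * |(L : ℝ)| * (7 * F Λ * H + 1)) := by
      gcongr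
    linarith
  -- In `q L b = q b' W ^ k` the power of `W` is coprime to the denominator and can be dropped.
  have hdvd : (x.den : ℤ) ∣ q * b' := by
    have h1 : (x.den : ℤ) ∣ (q * b') * (W : ℤ) ^ k := by
      rw [mul_assoc, ← hL, ← mul_assoc]
      exact dvd_mul_of_dvd_left hden _
    have h2 : IsCoprime (x.den : ℤ) ((W : ℤ) ^ k) :=
      (Nat.isCoprime_iff_coprime.2 hcop).pow_right
    exact h2.dvd_of_dvd_mul_right h1
  have hqb : (q * b' : ℤ) ≠ 0 := mul_ne_zero (by exact_mod_cast hq0.ne') hb'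
  have hle : (x.den : ℝ) ≤ q * |(b' : ℝ)| := by
    have h1 := Int.le_of_dvd (abs_pos.2 hqb) ((dvd_abs _ _).2 hdvd)
    rw [abs_mul, Nat.abs_cast] at h1
    exact_mod_cast h1
  refine ⟨x.den, x.den_pos, hle.trans (by gcongr), x.num, ?_⟩
  have h1 : (x : ℝ) * x.den = x.num := by exact_mod_cast Rat.mul_den_eq_num x
  have h2 : x.den * α - x.num = x.den * θ := by rw [hθ, ← h1]; ring
  rw [h2, abs_mul, Nat.abs_cast]
  calc _ ≤ q * |(b' : ℝ)| * |θ| * ((K : ℝ) ^ (d + 1) * |(L : ℝ)|) := by gcongr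
    _ = (|θ| * (q * |(L : ℝ)|) * (K : ℝ) ^ (d + 1)) * |(b' : ℝ)| := by ring
    _ ≤ _ := by gcongr

/-! ### Fourier analysis on `ℤ^D` -/

section Fourier

open MeasureTheory UnitAddTorus

/-- The Haar probability measure on the torus, the dual group of `ℤ^D`. -/
noncomputable def torusHaar (D : ℕ) : Measure (UnitAddTorus (Fin D)) :=
  Measure.pi fun _ => AddCircle.haarAddCircle

instance (D : ℕ) : IsProbabilityMeasure (torusHaar D) := by
  unfold torusHaar; infer_instance

theorem integral_mFourier {D : ℕ} (n : Fin D → ℤ) :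
    ∫ ξ, mFourier n ξ ∂torusHaar D = if n = 0 then 1 else 0 := by
  split_ifs with h
  · simp [h, mFourier_zero]
  · unfold torusHaar
    rw [mFourier, ContinuousMap.coe_mk, integral_fintype_prod_eq_prod]
    obtain ⟨i, hi⟩ := Function.ne_iff.mp h
    apply Finset.prod_eq_zero (Finset.mem_univ i)
    exact integral_eq_zero_of_add_right_eq_neg (fourier_add_half_inv_index hi one_pos)

theorem norm_mFourier_apply {D : ℕ} (n : Fin D → ℤ) (ξ : UnitAddTorus (Fin D)) :
    ‖mFourier n ξ‖ = 1 := by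
  rw [mFourier, ContinuousMap.coe_mk, norm_prod]
  exact Finset.prod_eq_one fun i _ => by rw [fourier_apply, Circle.norm_coe]

theorem mFourier_ne_zero {D : ℕ} (n : Fin D → ℤ) (ξ : UnitAddTorus (Fin D)) :
    mFourier n ξ ≠ 0 := by
  rw [← norm_ne_zero_iff, norm_mFourier_apply]; exact one_ne_zero

theorem mFourier_zsmul {D : ℕ} (v : Fin D → ℤ) (k : ℤ) (ξ : UnitAddTorus (Fin D)) :
    mFourier (k • v) ξ = mFourier v ξ ^ k := by
  have h0 := mFourier_ne_zero v ξ
  induction k with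
  | zero => simp [mFourier_zero]
  | succ k ih => rw [add_smul, mFourier_add, ih, one_smul, zpow_add_one₀ h0]
  | pred k ih =>
    rw [sub_smul, sub_eq_add_neg, mFourier_add, ih, one_smul, zpow_sub_one₀ h0, mFourier_neg]
    congr 1
    rw [Complex.inv_eq_conj (norm_mFourier_apply v ξ)]

theorem integrable_of_continuous {D : ℕ} {E : Type*} [NormedAddCommGroup E]
    {g : UnitAddTorus (Fin D) → E} (hg : Continuous g) : Integrable g (torusHaar D) :=
  hg.integrable_of_hasCompactSupport (HasCompactSupport.of_compactSpace g)

/-- The Fourier transform `ξ ↦ ∑_x g(x) e(-x · ξ)` of a finitely supported function on `ℤ^D`. With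
this sign, translating `g` to `x ↦ g(x + y)` multiplies the transform by `e(y · ξ)`. -/
noncomputable def fourierTransform {D : ℕ} (g : (Fin D → ℤ) → ℂ) (ξ : UnitAddTorus (Fin D)) : ℂ :=
  ∑' x, g x * mFourier (-x) ξ

section

variable {D : ℕ} {g : (Fin D → ℤ) → ℂ}

theorem fourierTransform_eq_sum (hg : g.support.Finite) (ξ : UnitAddTorus (Fin D)) :
    fourierTransform g ξ = ∑ x ∈ hg.toFinset, g x * mFourier (-x) ξ := by
  refine tsum_eq_sum fun x hx => ?_
  rw [Set.Finite.mem_toFinset, Function.notMem_support] at hx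
  rw [hx, zero_mul]

theorem continuous_fourierTransform (hg : g.support.Finite) :
    Continuous (fourierTransform g) := by
  have : fourierTransform g = fun ξ => ∑ x ∈ hg.toFinset, g x * mFourier (-x) ξ :=
    funext fun ξ => fourierTransform_eq_sum hg ξ
  rw [this]
  fun_prop

/-- Plancherel's identity. -/
theorem integral_norm_fourierTransform_sq (hg : g.support.Finite) :
    ∫ ξ, ‖fourierTransform g ξ‖ ^ 2 ∂torusHaar D = ∑' x, ‖g x‖ ^ 2 := by
  rw [tsum_eq_sum (s := hg.toFinset) (fun x hx => by
    rw [Set.Finite.mem_toFinset, Function.notMem_support] at hx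
    simp [hx])]
  have h1 : ∫ ξ, ((‖fourierTransform g ξ‖ ^ 2 : ℝ) : ℂ) ∂torusHaar D =
      ((∑ x ∈ hg.toFinset, ‖g x‖ ^ 2 : ℝ) : ℂ) := by
    have h2 : ∀ ξ, ((‖fourierTransform g ξ‖ ^ 2 : ℝ) : ℂ) =
        ∑ x ∈ hg.toFinset, ∑ y ∈ hg.toFinset,
          (g x * (starRingEnd ℂ) (g y)) * mFourier (y - x) ξ := by
      intro ξ
      rw [← Complex.normSq_eq_norm_sq, ← Complex.mul_conj, fourierTransform_eq_sum hg, map_sum,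
        Finset.sum_mul_sum]
      refine Finset.sum_congr rfl fun x _ => Finset.sum_congr rfl fun y _ => ?_
      rw [map_mul, ← mFourier_neg, neg_neg, sub_eq_add_neg, mFourier_add]
      ring
    simp_rw [h2]
    rw [integral_finsetSum _ fun x _ => integrable_of_continuous (by fun_prop)]
    push_cast
    refine Finset.sum_congr rfl fun x hx => ?_
    rw [integral_finsetSum _ fun y _ => integrable_of_continuous (by fun_prop)]
    simp_rw [integral_const_mul, integral_mFourier]
    rw [Finset.sum_eq_single x]
    · rw [sub_self, if_pos rfl, mul_one, Complex.mul_conj, Complex.normSq_eq_norm_sq]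
      push_cast; rfl
    · intro y _ hy
      rw [if_neg (sub_ne_zero.2 hy), mul_zero]
    · exact fun h => absurd hx h
  rw [integral_complex_ofReal] at h1
  exact_mod_cast h1

theorem finite_support_expect (hg : g.support.Finite) (s : Finset ℤ) (c : ℤ → Fin D → ℤ) :
    (Function.support fun x => 𝔼 z ∈ s, g (x + c z)).Finite := by
  have hfin : (⋃ z ∈ s, (fun x => x + c z) ⁻¹' g.support).Finite :=
    s.finite_toSet.biUnion fun z _ => hg.preimage (add_left_injective (c z)).injOn
  refine hfin.subset fun x hx => ?_
  by_contra hcon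
  simp only [Set.mem_iUnion, Set.mem_preimage, not_exists] at hcon
  apply hx
  exact Finset.expect_eq_zero fun z hz => Function.notMem_support.1 (hcon z hz)

theorem fourierTransform_expect (hg : g.support.Finite) (s : Finset ℤ) (c : ℤ → Fin D → ℤ)
    (ξ : UnitAddTorus (Fin D)) :
    fourierTransform (fun x => 𝔼 z ∈ s, g (x + c z)) ξ =
      (𝔼 z ∈ s, mFourier (c z) ξ) * fourierTransform g ξ := by
  have hshift : ∀ y : Fin D → ℤ, ∑' x, g (x + y) * mFourier (-x) ξ =
      mFourier y ξ * fourierTransform g ξ := by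
    intro y
    have h1 := (Equiv.addRight y).tsum_eq fun x => g x * mFourier (-(x - y)) ξ
    simp only [Equiv.coe_addRight, add_sub_cancel_right] at h1
    rw [h1, fourierTransform, ← tsum_mul_left]
    refine tsum_congr fun x => ?_
    rw [neg_sub, sub_eq_add_neg, mFourier_add]
    ring
  have hsum : ∀ y : Fin D → ℤ, Summable fun x => g (x + y) * mFourier (-x) ξ := by
    intro y
    refine summable_of_hasFiniteSupport ((hg.preimage (add_left_injective y).injOn).subset ?_)
    intro x hx
    exact left_ne_zero_of_mul hx
  unfold fourierTransform
  simp only [Finset.expect, NNRat.smul_def, mul_assoc, Finset.sum_mul]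
  rw [tsum_mul_left, Summable.tsum_finsetSum fun z _ => hsum (c z)]
  simp only [hshift]
  rfl

theorem tsum_norm_expect_sq (hg : g.support.Finite) (s : Finset ℤ) (a : ℤ → ℤ) (v : Fin D → ℤ) :
    ∑' x, ‖𝔼 z ∈ s, g (x + a z • v)‖ ^ 2 =
      ∫ ξ, ‖𝔼 z ∈ s, mFourier v ξ ^ a z‖ ^ 2 * ‖fourierTransform g ξ‖ ^ 2 ∂torusHaar D := by
  rw [← integral_norm_fourierTransform_sq (finite_support_expect hg s fun z => a z • v)]
  refine integral_congr_ae (Filter.Eventually.of_forall fun ξ => ?_)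
  simp only
  rw [fourierTransform_expect hg, norm_mul, mul_pow]
  simp only [mFourier_zsmul]

/-- Reversing the shifts conjugates the multiplier and keeps the energy. -/
theorem tsum_norm_expect_sq_neg (hg : g.support.Finite) (s : Finset ℤ) (a : ℤ → ℤ)
    (v : Fin D → ℤ) :
    ∑' x, ‖𝔼 z ∈ s, g (x - a z • v)‖ ^ 2 = ∑' x, ‖𝔼 z ∈ s, g (x + a z • v)‖ ^ 2 := by
  have h := tsum_norm_expect_sq hg s (fun z => -a z) v
  simp only [neg_smul, ← sub_eq_add_neg] at h
  rw [h, tsum_norm_expect_sq hg s a v]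
  refine integral_congr_ae (Filter.Eventually.of_forall fun ξ => ?_)
  simp only
  congr 2
  rw [← RCLike.norm_conj, map_expect]
  congr 1
  refine Finset.expect_congr rfl fun z _ => ?_
  rw [map_zpow₀, ← Complex.inv_eq_conj (norm_mFourier_apply v ξ), inv_zpow', neg_neg]

theorem norm_zpow_sub_one_le {u : ℂ} (hu : ‖u‖ = 1) (n : ℕ) : ‖u ^ n - 1‖ ≤ n * ‖u - 1‖ := by
  induction n with
  | zero => simp
  | succ n ih =>
    have h1 : u ^ (n + 1) - 1 = u * (u ^ n - 1) + (u - 1) := by ring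
    rw [h1]
    refine (norm_add_le _ _).trans ?_
    rw [norm_mul, hu, one_mul]
    push_cast
    linarith

theorem norm_expect_le_of_forall_le (s : Finset ℤ) (g : ℤ → ℂ) {c : ℝ} (hc : 0 ≤ c)
    (h : ∀ z ∈ s, ‖g z‖ ≤ c) : ‖𝔼 z ∈ s, g z‖ ≤ c := by
  rcases s.eq_empty_or_nonempty with rfl | hne
  · simpa using hc
  have hcard : (0 : ℝ) < s.card := by exact_mod_cast hne.card_pos
  rw [Finset.expect_eq_sum_div_card, norm_div, Complex.norm_natCast, div_le_iff₀ hcard, mul_comm,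
    ← nsmul_eq_mul]
  exact (norm_sum_le _ _).trans (Finset.sum_le_card_nsmul _ _ _ h)

theorem half_le_norm_expect (s : Finset ℤ) (hs : s.Nonempty) (g : ℤ → ℂ)
    (h : ∀ z ∈ s, ‖g z - 1‖ ≤ 1 / 2) : 1 / 2 ≤ ‖𝔼 z ∈ s, g z‖ := by
  have h1 : ‖𝔼 z ∈ s, (g z - 1)‖ ≤ 1 / 2 :=
    norm_expect_le_of_forall_le s _ (by norm_num) h
  rw [Finset.expect_sub_distrib, Finset.expect_const hs] at h1
  have h2 := norm_sub_norm_le (1 : ℂ) (1 - 𝔼 z ∈ s, g z)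
  rw [sub_sub_cancel, norm_one, norm_sub_rev] at h2
  linarith

/-- If the multiplier `𝔼_z u ^ a(z)` can be as large as `τ` only where some `u ^ q` with `q ≤ R` is
within `η` of `1`, then large energy of the averages of `g` over the shifts by `a(z) v` passes to the
averages along short progressions of step `q v`, for a single `q` independent of the progression. -/
theorem exists_progression_energy (hg : g.support.Finite) (v : Fin D → ℤ) (s : Finset ℤ)
    (a : ℤ → ℤ) (R : ℕ) (τ η M : ℝ) (hR : 0 < R) (hM : ∑' x, ‖g x‖ ^ 2 ≤ M)
    (hlarge : ∀ u : ℂ, ‖u‖ = 1 → τ ≤ ‖𝔼 z ∈ s, u ^ a z‖ →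
      ∃ q ∈ Finset.Icc 1 R, ‖u ^ q - 1‖ ≤ η)
    (hE : 4 * τ ^ 2 * M ≤ ∑' x, ‖𝔼 z ∈ s, g (x + a z • v)‖ ^ 2) :
    ∃ q ∈ Finset.Icc 1 R, ∀ t : Finset ℤ, t.Nonempty →
      (∀ z ∈ t, 0 ≤ z ∧ (z : ℝ) * η ≤ 1 / 2) →
      3 / 4 * τ ^ 2 * M / R ≤ ∑' x, ‖𝔼 z ∈ t, g (x + (q * z : ℤ) • v)‖ ^ 2 := by
  set μ := torusHaar D
  set F : UnitAddTorus (Fin D) → ℝ := fun ξ => ‖fourierTransform g ξ‖ ^ 2 with hF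
  have hFc : Continuous F := (continuous_fourierTransform hg).norm.pow 2
  have hFi : Integrable F μ := integrable_of_continuous hFc
  have hF0 : ∀ ξ, 0 ≤ F ξ := fun ξ => by positivity
  -- the frequencies at which the step `q v` is nearly trivial
  set S : ℕ → Set (UnitAddTorus (Fin D)) := fun q => {ξ | ‖mFourier v ξ ^ q - 1‖ ≤ η} with hS
  have hSm : ∀ q, MeasurableSet (S q) := fun q =>
    (isClosed_le (by fun_prop) continuous_const).measurableSet
  have hmc : ∀ (t : Finset ℤ) (b : ℤ → ℤ), Continuous fun ξ => 𝔼 z ∈ t, mFourier v ξ ^ b z := by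
    intro t b
    simp only [Finset.expect, NNRat.smul_def, ← mFourier_zsmul]
    fun_prop
  have hsum : 3 * τ ^ 2 * M ≤ ∑ q ∈ Finset.Icc 1 R, ∫ ξ in S q, F ξ ∂μ := by
    rw [tsum_norm_expect_sq hg] at hE
    have h1 : ∫ ξ, ‖𝔼 z ∈ s, mFourier v ξ ^ a z‖ ^ 2 * F ξ ∂μ ≤
        ∫ ξ, (τ ^ 2 * F ξ + ∑ q ∈ Finset.Icc 1 R, (S q).indicator F ξ) ∂μ := by
      refine integral_mono (integrable_of_continuous (((hmc s a).norm.pow 2).mul hFc))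
        ((hFi.const_mul _).add (integrable_finsetSum _ fun q _ => hFi.indicator (hSm q))) ?_
      intro ξ
      have hnn : ∀ q ∈ Finset.Icc 1 R, 0 ≤ (S q).indicator F ξ :=
        fun q _ => Set.indicator_nonneg (fun ξ _ => hF0 ξ) ξ
      simp only
      rcases lt_or_ge ‖𝔼 z ∈ s, mFourier v ξ ^ a z‖ τ with hlt | hge
      · have h2 : ‖𝔼 z ∈ s, mFourier v ξ ^ a z‖ ^ 2 ≤ τ ^ 2 := by gcongr
        have h3 := mul_le_mul_of_nonneg_right h2 (hF0 ξ)
        linarith [Finset.sum_nonneg hnn]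
      · obtain ⟨q, hq, hqη⟩ := hlarge _ (norm_mFourier_apply v ξ) hge
        have h2 : ‖𝔼 z ∈ s, mFourier v ξ ^ a z‖ ≤ 1 := by
          refine norm_expect_le_of_forall_le s _ zero_le_one fun z _ => ?_
          rw [norm_zpow, norm_mFourier_apply, one_zpow]
        have h3 : ‖𝔼 z ∈ s, mFourier v ξ ^ a z‖ ^ 2 ≤ 1 := pow_le_one₀ (norm_nonneg _) h2
        have h4 := mul_le_mul_of_nonneg_right h3 (hF0 ξ)
        have h5 := Finset.single_le_sum hnn hq
        rw [Set.indicator_of_mem (show ξ ∈ S q from hqη)] at h5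
        have := mul_nonneg (sq_nonneg τ) (hF0 ξ)
        linarith
    rw [integral_add (hFi.const_mul _) (integrable_finsetSum _ fun q _ => hFi.indicator (hSm q)),
      integral_const_mul, integral_finsetSum _ fun q _ => hFi.indicator (hSm q),
      integral_norm_fourierTransform_sq hg] at h1
    simp only [integral_indicator (hSm _)] at h1
    have h2 : τ ^ 2 * ∑' x, ‖g x‖ ^ 2 ≤ τ ^ 2 * M := by gcongr
    linarith
  have hRR : (0 : ℝ) < R := by exact_mod_cast hR
  obtain ⟨q, hq, hqI⟩ : ∃ q ∈ Finset.Icc 1 R, 3 * τ ^ 2 * M / R ≤ ∫ ξ in S q, F ξ ∂μ := by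
    refine Finset.exists_le_of_sum_le ⟨1, Finset.mem_Icc.2 ⟨le_rfl, hR⟩⟩ ?_
    rw [Finset.sum_const, Nat.card_Icc, Nat.add_sub_cancel, nsmul_eq_mul,
      mul_div_cancel₀ _ hRR.ne']
    exact hsum
  refine ⟨q, hq, fun t ht htη => ?_⟩
  rw [tsum_norm_expect_sq hg t (fun z => q * z) v]
  calc 3 / 4 * τ ^ 2 * M / R = 1 / 4 * (3 * τ ^ 2 * M / R) := by ring
    _ ≤ 1 / 4 * ∫ ξ in S q, F ξ ∂μ := by gcongr
    _ = ∫ ξ in S q, 1 / 4 * F ξ ∂μ := by rw [integral_const_mul]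
    _ ≤ ∫ ξ in S q, ‖𝔼 z ∈ t, mFourier v ξ ^ (q * z : ℤ)‖ ^ 2 * F ξ ∂μ := by
      refine setIntegral_mono_on (hFi.const_mul _).integrableOn
        (integrable_of_continuous (((hmc t _).norm.pow 2).mul hFc)).integrableOn (hSm q) ?_
      intro ξ hξ
      refine mul_le_mul_of_nonneg_right ?_ (hF0 ξ)
      have h1 : 1 / 2 ≤ ‖𝔼 z ∈ t, mFourier v ξ ^ (q * z : ℤ)‖ := by
        refine half_le_norm_expect t ht _ fun z hz => ?_
        obtain ⟨hz0, hzη⟩ := htη z hz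
        lift z to ℕ using hz0
        rw [zpow_mul, zpow_natCast, zpow_natCast]
        refine (norm_zpow_sub_one_le (by rw [norm_pow, norm_mFourier_apply, one_pow]) z).trans ?_
        refine le_trans ?_ hzη
        rw [Int.cast_natCast]
        gcongr
        exact hξ
      calc (1 / 4 : ℝ) = (1 / 2) ^ 2 := by norm_num
        _ ≤ _ := by gcongr
    _ ≤ _ := setIntegral_le_integral (integrable_of_continuous (((hmc t _).norm.pow 2).mul hFc))
        (Filter.Eventually.of_forall fun ξ => by positivity)

end

end Fourier

/-! ### The polynomial after the `W`- and `V`-tricks -/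

theorem beta_one_ne_zero {P : ℤ[X]} {ρ : ℤ} (h : P.rootMultiplicity ρ = 1) : beta P ρ 1 ≠ 0 := by
  have hP : P ≠ 0 := by
    rintro rfl
    simp at h
  have h1 : beta P ρ 1 = P.derivative.eval ρ := by
    unfold beta
    rw [← taylor_apply, taylor_coeff_one]
  have hroot : P.IsRoot ρ := (rootMultiplicity_pos hP).1 (by omega)
  rw [h1]
  intro h2
  have := (one_lt_rootMultiplicity_iff_isRoot hP).2 ⟨hroot, h2⟩
  omega

section

variable {P : ℤ[X]} {ρ : ℤ} {W V r : ℕ}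

theorem exists_wTrick_eq_X_add (hP : P.eval ρ = 0) (hβ : beta P ρ 1 ≠ 0) (hW : 0 < W) :
    ∃ G : ℤ[X], wTrick P ρ W = X + C (W : ℤ) * G := by
  have hW' : (W : ℤ) ≠ 0 := by exact_mod_cast hW.ne'
  have hc : beta P ρ 1 ^ 2 * (W : ℤ) ≠ 0 := mul_ne_zero (pow_ne_zero _ hβ) hW'
  have hcoeff : ∀ i, beta P ρ 1 ^ 2 * (W : ℤ) * (wTrick P ρ W).coeff i =
      beta P ρ i * (beta P ρ 1 * W) ^ i := by
    intro i
    rw [← coeff_C_mul, C_mul_wTrick P ρ W hP, coeff_comp_affine]; rfl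
  have hdvd : C (W : ℤ) ∣ wTrick P ρ W - X := by
    rw [C_dvd_iff_dvd_coeff]
    intro i
    have h := hcoeff i
    match i with
    | 0 =>
      have h0 : beta P ρ 0 = 0 := by
        unfold beta
        rw [← taylor_apply, taylor_coeff_zero, hP]
      rw [h0, zero_mul] at h
      rw [coeff_sub, (mul_eq_zero.1 h).resolve_left hc]
      simp
    | 1 =>
      have h1 : (wTrick P ρ W).coeff 1 = 1 := by
        apply mul_left_cancel₀ hc
        rw [h]; ring
      rw [coeff_sub, h1]
      simp
    | n + 2 =>
      have h1 : (wTrick P ρ W).coeff (n + 2) =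
          W * (beta P ρ (n + 2) * beta P ρ 1 ^ n * (W : ℤ) ^ n) := by
        apply mul_left_cancel₀ hc
        rw [h]; ring
      rw [coeff_sub, h1, coeff_X_of_ne_one (by omega), sub_zero]
      exact dvd_mul_right _ _
  obtain ⟨G, hG⟩ := hdvd
  exact ⟨G, by rw [← hG]; ring⟩

theorem vTrick_X_add (G : ℤ[X]) (hV : 0 < V) :
    vTrick (X + C (W : ℤ) * G) r V = X + C (W : ℤ) * vTrick G r V := by
  have hV' : (C (V : ℤ) : ℤ[X]) ≠ 0 := C_ne_zero.2 (by exact_mod_cast hV.ne')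
  apply mul_left_cancel₀ hV'
  rw [C_mul_vTrick, mul_add, mul_left_comm, C_mul_vTrick]
  simp only [add_comp, mul_comp, X_comp, C_comp, eval_add, eval_mul, eval_X, eval_C, C_add, C_mul]
  ring

theorem natDegree_wTrick (hP : P.eval ρ = 0) (hβ : beta P ρ 1 ≠ 0) (hW : 0 < W) :
    (wTrick P ρ W).natDegree = P.natDegree := by
  have hW' : (W : ℤ) ≠ 0 := by exact_mod_cast hW.ne'
  have h := congrArg natDegree (C_mul_wTrick P ρ W hP)
  rwa [natDegree_C_mul (mul_ne_zero (pow_ne_zero _ hβ) hW'), natDegree_comp,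
    natDegree_linear (mul_ne_zero hβ hW'), mul_one] at h

theorem leadingCoeff_wTrick (hP : P.eval ρ = 0) (hβ : beta P ρ 1 ≠ 0) (hW : 0 < W) :
    beta P ρ 1 ^ 2 * W * (wTrick P ρ W).leadingCoeff =
      P.leadingCoeff * (beta P ρ 1 * W) ^ P.natDegree := by
  have hW' : (W : ℤ) ≠ 0 := by exact_mod_cast hW.ne'
  have h := congrArg leadingCoeff (C_mul_wTrick P ρ W hP)
  rwa [leadingCoeff_mul, leadingCoeff_C, leadingCoeff_comp
    (by rw [natDegree_linear (mul_ne_zero hβ hW')]; exact one_ne_zero),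
    leadingCoeff_linear (mul_ne_zero hβ hW')] at h

theorem natDegree_vTrick (Q : ℤ[X]) (hV : 0 < V) : (vTrick Q r V).natDegree = Q.natDegree := by
  have hV' : (V : ℤ) ≠ 0 := by exact_mod_cast hV.ne'
  have h := congrArg natDegree (C_mul_vTrick Q r V)
  rwa [natDegree_C_mul hV', natDegree_sub_C, natDegree_comp, natDegree_linear hV', mul_one] at h

theorem leadingCoeff_vTrick (Q : ℤ[X]) (hV : 0 < V) (hQ : 0 < Q.natDegree) :
    V * (vTrick Q r V).leadingCoeff = Q.leadingCoeff * (V : ℤ) ^ Q.natDegree := by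
  have hV' : (V : ℤ) ≠ 0 := by exact_mod_cast hV.ne'
  have h := congrArg leadingCoeff (C_mul_vTrick Q r V)
  have hdeg : (Q.comp (C (V : ℤ) * X + C (r : ℤ))).natDegree = Q.natDegree := by
    rw [natDegree_comp, natDegree_linear hV', mul_one]
  rwa [leadingCoeff_mul, leadingCoeff_C, leadingCoeff_sub_of_degree_lt, leadingCoeff_comp
    (by rw [natDegree_linear hV']; exact one_ne_zero), leadingCoeff_linear hV'] at h
  refine degree_C_le.trans_lt ?_
  rw [← natDegree_pos_iff_degree_pos, hdeg]
  exact hQ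

/-- The leading coefficient is `β_d β₁^{d-2} (W V)^{d-1}` for a polynomial of degree `d`, written here
without divisions and with `d + 1` in place of `d`. -/
theorem leadingCoeff_vTrick_wTrick (hP : P.eval ρ = 0) (hβ : beta P ρ 1 ≠ 0) (hW : 0 < W)
    (hV : 0 < V) {d : ℕ} (hd : P.natDegree = d + 1) :
    beta P ρ 1 ^ 2 * (vTrick (wTrick P ρ W) r V).leadingCoeff =
      P.leadingCoeff * beta P ρ 1 ^ (d + 1) * ((W : ℤ) * V) ^ d := by
  have hW' : (W : ℤ) ≠ 0 := by exact_mod_cast hW.ne'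
  have hV' : (V : ℤ) ≠ 0 := by exact_mod_cast hV.ne'
  have hdeg := natDegree_wTrick hP hβ hW
  have h1 := leadingCoeff_wTrick hP hβ hW
  have h2 := leadingCoeff_vTrick (r := r) (wTrick P ρ W) hV (by omega)
  rw [hdeg, hd] at h2
  rw [hd] at h1
  apply mul_left_cancel₀ (mul_ne_zero hW' hV')
  calc _ = beta P ρ 1 ^ 2 * W * (V * (vTrick (wTrick P ρ W) r V).leadingCoeff) := by ring
    _ = (beta P ρ 1 ^ 2 * W * (wTrick P ρ W).leadingCoeff) * (V : ℤ) ^ (d + 1) := by rw [h2]; ring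
    _ = _ := by rw [h1]; ring

theorem eval_vTrick_wTrick (hP : P.eval ρ = 0) (z : ℤ) :
    beta P ρ 1 ^ 2 * W * (V * (vTrick (wTrick P ρ W) r V).eval z) =
      P.eval (beta P ρ 1 * W * (V * z + r) + ρ) - P.eval (beta P ρ 1 * W * r + ρ) := by
  have h1 := congrArg (eval z) (C_mul_vTrick (wTrick P ρ W) r V)
  have h2 := fun y => congrArg (eval y) (C_mul_wTrick P ρ W hP)
  simp only [eval_mul, eval_sub, eval_comp, eval_add, eval_X, eval_C] at h1 h2
  rw [h1, mul_sub, h2, h2]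

end

theorem exists_abs_eval_sub_le (P : ℤ[X]) (d : ℕ) (hd : P.natDegree = d + 1) :
    ∃ c : ℝ, 0 ≤ c ∧ ∀ (x y : ℤ) (M : ℝ), 1 ≤ M → |(x : ℝ)| ≤ M → |(y : ℝ)| ≤ M →
      |((P.eval x : ℤ) : ℝ) - (P.eval y : ℤ)| ≤ c * |(x : ℝ) - y| * M ^ d := by
  refine ⟨∑ i ∈ Finset.range (d + 2), |(P.coeff i : ℝ)| * i,
    Finset.sum_nonneg fun i _ => by positivity, ?_⟩
  intro x y M hM hx hy
  have h1 : ((P.eval x : ℤ) : ℝ) - (P.eval y : ℤ) =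
      ∑ i ∈ Finset.range (d + 2), (P.coeff i : ℝ) * ((x : ℝ) ^ i - (y : ℝ) ^ i) := by
    rw [eval_eq_sum_range, eval_eq_sum_range, hd]
    push_cast
    rw [← Finset.sum_sub_distrib]
    exact Finset.sum_congr rfl fun i _ => by ring
  rw [h1, Finset.sum_mul, Finset.sum_mul]
  refine (Finset.abs_sum_le_sum_abs _ _).trans (Finset.sum_le_sum fun i hi => ?_)
  rw [abs_mul, mul_assoc, mul_assoc]
  refine mul_le_mul_of_nonneg_left ?_ (abs_nonneg _)
  have hi' := Finset.mem_range.1 hi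
  calc _ ≤ |(x : ℝ) - y| * i * max |(x : ℝ)| |(y : ℝ)| ^ (i - 1) := abs_pow_sub_pow_le _ _ _
    _ ≤ |(x : ℝ) - y| * i * M ^ (i - 1) := by gcongr; exact max_le hx hy
    _ ≤ |(x : ℝ) - y| * i * M ^ d := by
        have : i - 1 ≤ d := by omega
        gcongr
    _ = _ := by ring

/-- The increments of the tricked polynomial on `[K]` are controlled by its leading coefficient,
uniformly in `W`, `V` and `r`: evaluating it at `z` amounts to evaluating `P` at a point of size
`O(W V K)`. -/
theorem exists_abs_eval_vTrick_sub_le (P : ℤ[X]) (ρ : ℤ) (d : ℕ) (hd : P.natDegree = d + 1)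
    (hP : P.eval ρ = 0) (hβ : beta P ρ 1 ≠ 0) :
    ∃ c : ℝ, 0 ≤ c ∧ ∀ (W V r K z z' : ℕ), 0 < W → r < V → z < K → z' < K →
      |(((vTrick (wTrick P ρ W) r V).eval (z : ℤ) : ℤ) : ℝ) -
        ((vTrick (wTrick P ρ W) r V).eval (z' : ℤ) : ℤ)| ≤
      c * |((vTrick (wTrick P ρ W) r V).leadingCoeff : ℝ)| * |(z : ℝ) - z'| * (K : ℝ) ^ d := by
  obtain ⟨c, hc, hlip⟩ := exists_abs_eval_sub_le P d hd
  set β := beta P ρ 1 with hβdef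
  have hβR : (1 : ℝ) ≤ |(β : ℝ)| := by exact_mod_cast Int.one_le_abs hβ
  refine ⟨c * (|(β : ℝ)| + |(ρ : ℝ)|) ^ d * (β : ℝ) ^ 2, by positivity, ?_⟩
  intro W V r K z z' hW hr hz hz'
  have hV : 0 < V := by omega
  have hWR : (1 : ℝ) ≤ W := by exact_mod_cast hW
  have hVR : (1 : ℝ) ≤ V := by exact_mod_cast hV
  have hKR : (1 : ℝ) ≤ K := by exact_mod_cast (show 1 ≤ K by omega)
  set Q := vTrick (wTrick P ρ W) r V with hQ
  set M : ℝ := (|(β : ℝ)| + |(ρ : ℝ)|) * (W * V * K) with hM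
  have hWVK : (1 : ℝ) ≤ W * V * K := one_le_mul_of_one_le_of_one_le
    (one_le_mul_of_one_le_of_one_le hWR hVR) hKR
  have hM1 : 1 ≤ M := one_le_mul_of_one_le_of_one_le
    (by linarith [abs_nonneg (ρ : ℝ)]) hWVK
  have hpt : ∀ y : ℕ, y < K → |((β * W * (V * y + r) + ρ : ℤ) : ℝ)| ≤ M := by
    intro y hy
    have h1 : V * y + r ≤ V * K := by
      calc V * y + r ≤ V * y + V := by omega
        _ = V * (y + 1) := by ring
        _ ≤ V * K := Nat.mul_le_mul_left _ hy
    have h2 : ((V * y + r : ℕ) : ℝ) ≤ V * K := by exact_mod_cast h1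
    push_cast at h2 ⊢
    refine (abs_add_le _ _).trans ?_
    rw [abs_mul, abs_mul, Nat.abs_cast, abs_of_nonneg (by positivity : (0 : ℝ) ≤ V * y + r), hM,
      add_mul]
    have h3 : |(β : ℝ)| * W * (V * y + r) ≤ |(β : ℝ)| * (W * V * K) := by
      calc |(β : ℝ)| * W * (V * y + r) ≤ |(β : ℝ)| * W * (V * K) := by gcongr
        _ = _ := by ring
    have h4 : |(ρ : ℝ)| * 1 ≤ |(ρ : ℝ)| * (W * V * K) := by gcongr
    linarith
  have h1 := hlip _ _ M hM1 (hpt z hz) (hpt z' hz')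
  have e1 := eval_vTrick_wTrick (W := W) (V := V) (r := r) hP (z : ℤ)
  have e2 := eval_vTrick_wTrick (W := W) (V := V) (r := r) hP (z' : ℤ)
  rw [← hβdef, ← hQ] at e1 e2
  have e1' : (β : ℝ) ^ 2 * W * (V * (Q.eval (z : ℤ) : ℤ)) =
      (P.eval (β * W * (V * z + r) + ρ) : ℤ) - (P.eval (β * W * r + ρ) : ℤ) := by exact_mod_cast e1
  have e2' : (β : ℝ) ^ 2 * W * (V * (Q.eval (z' : ℤ) : ℤ)) =
      (P.eval (β * W * (V * z' + r) + ρ) : ℤ) - (P.eval (β * W * r + ρ) : ℤ) := by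
    exact_mod_cast e2
  have h2 : ((P.eval (β * W * (V * z + r) + ρ) : ℤ) : ℝ) - (P.eval (β * W * (V * z' + r) + ρ) : ℤ)
      = β ^ 2 * W * V * ((Q.eval (z : ℤ) : ℤ) - (Q.eval (z' : ℤ) : ℤ)) := by
    linear_combination e2' - e1'
  have h3 : ((β * W * (V * z + r) + ρ : ℤ) : ℝ) - (β * W * (V * z' + r) + ρ : ℤ) =
      β * W * V * (z - z') := by push_cast; ring
  rw [h2, h3, abs_mul, abs_mul (_ * _) ((z : ℝ) - z'), abs_mul _ (V : ℝ), abs_mul _ (W : ℝ),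
    abs_mul _ (V : ℝ), abs_mul _ (W : ℝ), Nat.abs_cast, Nat.abs_cast, abs_pow] at h1
  -- the leading coefficient controls `(W V) ^ d`
  have hL := leadingCoeff_vTrick_wTrick (r := r) hP hβ hW hV hd
  rw [← hβdef, ← hQ] at hL
  have hlc : P.leadingCoeff ≠ 0 := by
    rw [Ne, leadingCoeff_eq_zero]
    rintro rfl
    simp at hd
  have hL' : ((W : ℝ) * V) ^ d ≤ (β : ℝ) ^ 2 * |(Q.leadingCoeff : ℝ)| := by
    have h4 : (β : ℝ) ^ 2 * (Q.leadingCoeff : ℝ) =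
        ((P.leadingCoeff * β ^ (d + 1) : ℤ) : ℝ) * (W * V) ^ d := by exact_mod_cast hL
    have h5 : (1 : ℝ) ≤ |((P.leadingCoeff * β ^ (d + 1) : ℤ) : ℝ)| := by
      exact_mod_cast Int.one_le_abs (mul_ne_zero hlc (pow_ne_zero _ hβ))
    have h6 := congrArg abs h4
    rw [abs_mul, abs_mul, abs_of_nonneg (by positivity : (0:ℝ) ≤ (β : ℝ) ^ 2),
      abs_of_nonneg (by positivity : (0 : ℝ) ≤ (W * V) ^ d)] at h6
    rw [h6]
    exact le_mul_of_one_le_left (by positivity) h5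
  have hpos : 0 < |(β : ℝ)| ^ 2 * W * V := by positivity
  refine le_of_mul_le_mul_left ?_ hpos
  refine h1.trans ?_
  calc c * (|(β : ℝ)| * W * V * |(z : ℝ) - z'|) * M ^ d
      = |(β : ℝ)| * (W * V * (c * (|(β : ℝ)| + |(ρ : ℝ)|) ^ d * |(z : ℝ) - z'| * K ^ d) *
        (W * V) ^ d) := by rw [hM, mul_pow, mul_pow ((W : ℝ) * V)]; ring
    _ ≤ |(β : ℝ)| ^ 2 * (W * V * (c * (|(β : ℝ)| + |(ρ : ℝ)|) ^ d * |(z : ℝ) - z'| * K ^ d) *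
        ((β : ℝ) ^ 2 * |(Q.leadingCoeff : ℝ)|)) := by
        gcongr
        exact le_self_pow₀ hβR two_ne_zero
    _ = _ := by ring

/-! ### Major arcs and the energy of the two-point count -/

theorem seg_eq_map {x : ℝ} (hx : 0 ≤ x) :
    seg x = (Finset.range ⌊x⌋₊).map Nat.castEmbedding := by
  ext z
  rw [seg, Finset.mem_Icc, Finset.mem_map, Int.floor_sub_one, ← Int.natCast_floor_eq_floor hx]
  constructor
  · rintro ⟨h0, h1⟩
    lift z to ℕ using h0
    exact ⟨z, Finset.mem_range.2 (by omega), rfl⟩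
  · rintro ⟨n, hn, rfl⟩
    have := Finset.mem_range.1 hn
    simp only [Nat.castEmbedding_apply]
    omega

theorem expect_seg {x : ℝ} (hx : 0 ≤ x) (g : ℤ → ℂ) :
    𝔼 z ∈ seg x, g z = (∑ z ∈ Finset.range ⌊x⌋₊, g (z : ℤ)) / ⌊x⌋₊ := by
  rw [Finset.expect_eq_sum_div_card, seg_eq_map hx, Finset.sum_map, Finset.card_map,
    Finset.card_range]
  rfl

theorem card_seg_natCast (N : ℕ) : (seg N).card = N := by
  rw [seg_eq_map N.cast_nonneg, Finset.card_map, Finset.card_range, Nat.floor_natCast]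

/-- Integer powers of a unit complex number as values of the character `e`. -/
theorem exists_e_eq {u : ℂ} (hu : ‖u‖ = 1) : ∃ α : ℝ, ∀ k : ℤ, u ^ k = e (α * k) := by
  refine ⟨u.arg / (2 * Real.pi), fun k => ?_⟩
  have h1 : u = Complex.exp (u.arg * Complex.I) := by
    conv_lhs => rw [← Complex.norm_mul_exp_arg_mul_I u, hu]
    simp
  conv_lhs => rw [h1, ← Complex.exp_int_mul]
  unfold e
  congr 1
  have := Real.pi_pos.ne'
  push_cast
  field_simp

/-- Major arcs: if the average of `u ^ Q(z)` over `[K]` is at least `δ / 2`, then `u ^ q` is within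
`δ^{-O(1)} / N` of `1` for some `q = δ^{-O(1)}`, where the implied constants depend only on `P` and
`ρ`. The hypothesis on `N` also gives `N > 0`. -/
theorem exists_major_arc (P : ℤ[X]) (ρ : ℤ) (hρ : P.rootMultiplicity ρ = 1) :
    ∃ C₂ c B₀ : ℕ, 0 < C₂ ∧ 0 < B₀ ∧ ∀ (W m V r N : ℕ) (δ : ℝ), 0 < W → V = W ^ m → r < V →
      0 < δ → δ < 1 / 10 →
      C₂ * |((vTrick (wTrick P ρ W) r V).leadingCoeff : ℝ)| ^ C₂ * δ⁻¹ ^ C₂ ≤ N →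
      0 < N ∧ ∀ u : ℂ, ‖u‖ = 1 → δ / 2 ≤ ‖𝔼 z ∈ seg (scale (vTrick (wTrick P ρ W) r V) N),
        u ^ (vTrick (wTrick P ρ W) r V).eval z‖ →
      ∃ q : ℕ, 0 < q ∧ (q : ℝ) ≤ B₀ * δ⁻¹ ^ c ∧ ‖u ^ q - 1‖ ≤ B₀ * δ⁻¹ ^ c / N := by
  have hβ := beta_one_ne_zero hρ
  have hP0 : P ≠ 0 := by
    rintro rfl
    simp at hρ
  have hP : P.eval ρ = 0 := (rootMultiplicity_pos hP0).1 (by omega)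
  obtain ⟨d, hd⟩ : ∃ d, P.natDegree = d + 1 := by
    refine Nat.exists_eq_succ_of_ne_zero fun h0 => ?_
    rw [natDegree_eq_zero] at h0
    obtain ⟨a, rfl⟩ := h0
    simp at hP
    simp [hP] at hP0
  obtain ⟨F, hFg, hF⟩ := exists_approx_of_large_sum d
  obtain ⟨cP, hcP, hlip⟩ := exists_abs_eval_vTrick_sub_le P ρ d hd hP hβ
  have hXg : PolyGrowth fun t => t * (F t * (7 * F t * cP + 1)) :=
    PolyGrowth.self.mul (hFg.mul ((((PolyGrowth.const (by norm_num)).mul hFg).mul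
      (PolyGrowth.const hcP)).add (PolyGrowth.const zero_le_one)))
  obtain ⟨c₁, hX⟩ := hXg
  obtain ⟨c, hc⟩ := hFg
  set b' : ℤ := P.leadingCoeff * beta P ρ 1 ^ (d + 1) with hb'
  have hb'0 : b' ≠ 0 := mul_ne_zero (leadingCoeff_ne_zero.2 hP0) (pow_ne_zero _ hβ)
  -- `C₂` exceeds both the constant and the two exponents needed to make the scale large.
  set C₂ : ℕ := (2 * c₁ + 3) ^ (d + 1) * 2 ^ (c₁ * (d + 1)) + (c₁ * (d + 1) + (2 * (d + 1) + 1))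
    with hC₂
  set B₀ : ℕ := (c * 2 ^ c + 1) * b'.natAbs * (7 * 2 ^ (d + 1)) with hB₀
  have hb'pos : 0 < b'.natAbs := Int.natAbs_pos.2 hb'0
  refine ⟨C₂, c, B₀, by omega, by positivity, ?_⟩
  intro W m V r N δ hW hVW hr hδ hδ' hN
  have hV : 0 < V := by omega
  set Q := vTrick (wTrick P ρ W) r V with hQ
  set L : ℝ := |(Q.leadingCoeff : ℝ)| with hLdef
  obtain ⟨G₁, hG₁⟩ := exists_wTrick_eq_X_add hP hβ hW
  have hQG : Q = X + C (W : ℤ) * vTrick G₁ r V := by rw [hQ, hG₁, vTrick_X_add G₁ hV]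
  have hQd : Q.natDegree = d + 1 := by
    rw [hQ, natDegree_vTrick _ hV, natDegree_wTrick hP hβ hW, hd]
  have hQL : Q.leadingCoeff * beta P ρ 1 ^ 2 = b' * (W : ℤ) ^ ((m + 1) * d) := by
    rw [mul_comm, hQ, leadingCoeff_vTrick_wTrick hP hβ hW hV hd, hb', hVW]
    push_cast
    ring
  have hL1 : 1 ≤ L := by
    rw [hLdef]
    exact_mod_cast Int.one_le_abs (leadingCoeff_ne_zero.2 (by
      intro h0
      rw [h0, natDegree_zero] at hQd
      omega))
  have hL0 : 0 < L := by linarith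
  have hδinv : 10 ≤ δ⁻¹ := by
    rw [le_inv_comm₀ (by norm_num) hδ]; linarith
  have hδinv1 : 1 ≤ δ⁻¹ := by linarith
  set Λ : ℝ := 2 * δ⁻¹ with hΛdef
  have hΛ : 1 ≤ Λ := by linarith
  obtain ⟨hX0, hX1⟩ := hX Λ hΛ
  obtain ⟨hF0, hF1⟩ := hc Λ hΛ
  set κ := scale Q N with hκ
  have hNR : (0 : ℝ) ≤ N := N.cast_nonneg
  have hκ0 : 0 ≤ κ := by rw [hκ, scale]; positivity
  have hκpow : κ ^ (d + 1) = N / L := by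
    rw [hκ, scale, hQd, ← Real.rpow_natCast, ← Real.rpow_mul (by positivity)]
    have : (1 : ℝ) / ((d + 1 : ℕ) : ℝ) * ((d + 1 : ℕ) : ℝ) = 1 := by
      field_simp
    rw [this, Real.rpow_one]
  -- the lower bound on `N` makes the scale large
  have hκbig : (2 * c₁ + 3) * Λ ^ c₁ * L ^ 2 ≤ κ := by
    refine le_of_pow_le_pow_left₀ (Nat.succ_ne_zero d) hκ0 ?_
    rw [hκpow, le_div_iff₀ hL0]
    refine le_trans ?_ hN
    calc ((2 * c₁ + 3) * Λ ^ c₁ * L ^ 2) ^ (d + 1) * L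
        = (((2 * c₁ + 3) ^ (d + 1) * 2 ^ (c₁ * (d + 1)) : ℕ) : ℝ) * L ^ (2 * (d + 1) + 1) *
          δ⁻¹ ^ (c₁ * (d + 1)) := by
          rw [hΛdef, mul_pow _ (L ^ 2), mul_pow _ ((2 * δ⁻¹) ^ c₁)]; push_cast; ring
      _ ≤ C₂ * L ^ C₂ * δ⁻¹ ^ C₂ := by
          have h1 : (2 * c₁ + 3) ^ (d + 1) * 2 ^ (c₁ * (d + 1)) ≤ C₂ := by omega
          have h2 : 2 * (d + 1) + 1 ≤ C₂ := by omega
          have h3 : c₁ * (d + 1) ≤ C₂ := by omega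
          gcongr
  have hΛc : 1 ≤ Λ ^ c₁ := one_le_pow₀ hΛ
  have hL2 : 1 ≤ L ^ 2 := one_le_pow₀ hL1
  have hΛL : 1 ≤ Λ ^ c₁ * L ^ 2 := one_le_mul_of_one_le_of_one_le hΛc hL2
  have hκ2 : 2 * (c₁ * Λ ^ c₁ * L ^ 2) + 3 ≤ κ := by
    calc 2 * (c₁ * Λ ^ c₁ * L ^ 2) + 3 ≤ 2 * (c₁ * Λ ^ c₁ * L ^ 2) + 3 * (Λ ^ c₁ * L ^ 2) := by
          linarith
      _ = (2 * c₁ + 3) * Λ ^ c₁ * L ^ 2 := by ring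
      _ ≤ κ := hκbig
  set K := ⌊κ⌋₊ with hK
  have hKκ : κ < K + 1 := Nat.lt_floor_add_one κ
  have hnn : 0 ≤ c₁ * Λ ^ c₁ * L ^ 2 := by positivity
  have hK1 : (1 : ℝ) ≤ K := by linarith
  have hKpos : 0 < K := by exact_mod_cast (by linarith : (0 : ℝ) < K)
  have hκK : κ ≤ 2 * K := by linarith
  have hNL : (N : ℝ) ≤ 2 ^ (d + 1) * ((K : ℝ) ^ (d + 1) * L) := by
    have h1 : κ ^ (d + 1) ≤ (2 * K) ^ (d + 1) := by gcongr
    rw [hκpow, div_le_iff₀ hL0, mul_pow] at h1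
    linarith
  have hNpos : (0 : ℝ) < N := by
    refine lt_of_lt_of_le ?_ hN
    have : (0 : ℝ) < C₂ := by exact_mod_cast (by omega : 0 < C₂)
    positivity
  refine ⟨by exact_mod_cast hNpos, fun u hu hlarge => ?_⟩
  obtain ⟨α, hα⟩ := exists_e_eq hu
  rw [expect_seg hκ0, norm_div, Complex.norm_natCast, le_div_iff₀ (by linarith)] at hlarge
  simp only [hα] at hlarge
  have hS : (K : ℝ) ≤ Λ * ‖∑ z ∈ Finset.range K, e (α * (Q.eval (z : ℤ) : ℤ))‖ := by
    calc (K : ℝ) = Λ * (δ / 2 * K) := by rw [hΛdef]; field_simp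
      _ ≤ _ := by gcongr
  obtain ⟨q, hq0, hq1, a, ha⟩ := hF Q (vTrick G₁ r V) W ((m + 1) * d) (beta P ρ 1 ^ 2) b' α
    (cP * L) Λ K hQG hQd hb'0 hQL hKpos hΛ (by positivity)
    (fun z z' hz hz' => hlip W V r K z z' hW hr hz hz')
    (by
      calc Λ * (F Λ * L * (7 * F Λ * (cP * L) + 1))
          ≤ Λ * (F Λ * L * (7 * F Λ * (cP * L) + L)) := by gcongr
        _ = Λ * (F Λ * (7 * F Λ * cP + 1)) * L ^ 2 := by ring
        _ ≤ c₁ * Λ ^ c₁ * L ^ 2 := by gcongr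
        _ < K := by linarith)
    hS
  have hB : F Λ * |(b' : ℝ)| * (7 * 2 ^ (d + 1)) ≤ B₀ * δ⁻¹ ^ c := by
    have h1 : F Λ ≤ (c * 2 ^ c + 1) * δ⁻¹ ^ c := by
      calc F Λ ≤ c * Λ ^ c := hF1
        _ = c * 2 ^ c * δ⁻¹ ^ c := by rw [hΛdef]; ring
        _ ≤ _ := by gcongr; linarith
    have h2 : ((b'.natAbs : ℕ) : ℝ) = |(b' : ℝ)| := by rw [Nat.cast_natAbs]; push_cast; rfl
    calc F Λ * |(b' : ℝ)| * (7 * 2 ^ (d + 1))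
        ≤ (c * 2 ^ c + 1) * δ⁻¹ ^ c * |(b' : ℝ)| * (7 * 2 ^ (d + 1)) := by gcongr
      _ = _ := by rw [hB₀]; push_cast [h2]; ring
  have hFb : 0 ≤ F Λ * |(b' : ℝ)| := by positivity
  have h2d : (1 : ℝ) ≤ 2 ^ (d + 1) := one_le_pow₀ one_le_two
  refine ⟨q, hq0, ?_, ?_⟩
  · refine hq1.trans (le_trans ?_ hB)
    exact le_mul_of_one_le_right hFb (by linarith)
  · have h1 : ‖u ^ q - 1‖ ≤ 2 * Real.pi * |q * α - a| := by
      have h2 := norm_e_sub_e_le (q * α) a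
      rw [e_intCast] at h2
      rw [← zpow_natCast, hα]
      rwa [Int.cast_natCast, mul_comm α]
    rw [le_div_iff₀ hNpos]
    calc ‖u ^ q - 1‖ * N ≤ (7 * |q * α - a|) * (2 ^ (d + 1) * ((K : ℝ) ^ (d + 1) * L)) := by
          gcongr
          refine h1.trans ?_
          gcongr
          linarith [Real.pi_lt_d2]
      _ = (|q * α - a| * ((K : ℝ) ^ (d + 1) * L)) * (7 * 2 ^ (d + 1)) := by ring
      _ ≤ F Λ * |(b' : ℝ)| * (7 * 2 ^ (d + 1)) := by gcongr
      _ ≤ _ := hB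

section

variable {D N : ℕ} {f g : (Fin D → ℤ) → ℂ}

theorem SupportedOnBox.support_subset (hf : SupportedOnBox N f) :
    f.support ⊆ Fintype.piFinset fun _ : Fin D => seg N := by
  intro x hx
  rw [Finset.mem_coe, Fintype.mem_piFinset]
  exact hf x hx

theorem SupportedOnBox.finite (hf : SupportedOnBox N f) : f.support.Finite :=
  (Finset.finite_toSet _).subset hf.support_subset

theorem card_box (D N : ℕ) : (Fintype.piFinset fun _ : Fin D => seg N).card = N ^ D := by
  rw [Fintype.card_piFinset]
  simp [card_seg_natCast]

theorem tsum_norm_sq_le (hf : OneBounded f) (hf' : SupportedOnBox N f) :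
    ∑' x, ‖f x‖ ^ 2 ≤ (N : ℝ) ^ D := by
  rw [tsum_eq_sum (s := Fintype.piFinset fun _ : Fin D => seg N) fun x hx => by
    have : f x = 0 := by
      by_contra h
      exact hx (hf'.support_subset h)
    simp [this]]
  calc _ ≤ ∑ x ∈ Fintype.piFinset fun _ : Fin D => seg N, (1 : ℝ) :=
        Finset.sum_le_sum fun x _ => pow_le_one₀ (norm_nonneg _) (hf x)
    _ = _ := by simp [card_seg_natCast]

/-- Cauchy–Schwarz against a `1`-bounded function supported on a box. -/
theorem norm_tsum_mul_sq_le (hf : OneBounded f) (hf' : SupportedOnBox N f)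
    (hg : g.support.Finite) : ‖∑' x, f x * g x‖ ^ 2 ≤ (N : ℝ) ^ D * ∑' x, ‖g x‖ ^ 2 := by
  have hs : Summable fun x => ‖g x‖ ^ 2 :=
    summable_of_hasFiniteSupport (hg.subset fun x hx h => hx (by simp [h]))
  rw [tsum_eq_sum (s := Fintype.piFinset fun _ : Fin D => seg N) fun x hx => by
    have : f x = 0 := by
      by_contra h
      exact hx (hf'.support_subset h)
    rw [this, zero_mul]]
  calc _ ≤ (∑ x ∈ Fintype.piFinset fun _ : Fin D => seg N, ‖g x‖) ^ 2 := by
        gcongr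
        refine (norm_sum_le _ _).trans (Finset.sum_le_sum fun x _ => ?_)
        rw [norm_mul]
        exact mul_le_of_le_one_left (norm_nonneg _) (hf x)
    _ ≤ _ := sq_sum_le_card_mul_sum_sq
    _ ≤ _ := by
        rw [card_box]
        push_cast
        gcongr
        exact hs.sum_le_tsum _ fun x _ => by positivity

theorem tsum_expect_comm (hf : f.support.Finite) (s : Finset ℤ) (c : ℤ → Fin D → ℤ) :
    ∑' x, 𝔼 z ∈ s, f x * g (x + c z) = ∑' x, g x * 𝔼 z ∈ s, f (x - c z) := by
  have h1 : ∀ y : Fin D → ℤ, ∑' x, f x * g (x + y) = ∑' x, f (x - y) * g x := by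
    intro y
    have h := (Equiv.addRight y).tsum_eq fun x => f (x - y) * g x
    simpa using h
  have hs1 : ∀ y : Fin D → ℤ, Summable fun x => f x * g (x + y) := fun y =>
    summable_of_hasFiniteSupport (hf.subset fun x hx => left_ne_zero_of_mul hx)
  have hs2 : ∀ y : Fin D → ℤ, Summable fun x => f (x - y) * g x := fun y =>
    summable_of_hasFiniteSupport ((hf.preimage (sub_left_injective (b := y)).injOn).subset
      fun x hx => left_ne_zero_of_mul hx)
  simp only [Finset.mul_expect]
  simp only [Finset.expect, NNRat.smul_def, mul_comm (g _)]
  rw [tsum_mul_left, tsum_mul_left, Summable.tsum_finsetSum fun z _ => hs1 (c z),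
    Summable.tsum_finsetSum fun z _ => hs2 (c z)]
  simp only [h1]

end

/-- A large two-point count gives large energy to each of the two functions, by Cauchy–Schwarz
against the other. -/
theorem le_tsum_norm_expect_sq {D N : ℕ} (hN : 0 < N) {Q : ℤ[X]} {v : Fin D → ℤ}
    {f : Fin 2 → (Fin D → ℤ) → ℂ} {δ : ℝ} (hδ : 0 ≤ δ) (hf : ∀ i, OneBounded (f i))
    (hf' : ∀ i, SupportedOnBox N (f i))
    (h : δ * (N : ℝ) ^ D ≤ ‖twoPointCount Q N v (f 0) (f 1)‖) (i : Fin 2) :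
    δ ^ 2 * (N : ℝ) ^ D ≤ ∑' x, ‖𝔼 z ∈ seg (scale Q N), f i (x + Q.eval z • v)‖ ^ 2 := by
  have hND : (0 : ℝ) < (N : ℝ) ^ D := by
    have : (0 : ℝ) < N := by exact_mod_cast hN
    positivity
  have key : ∀ E : ℝ, ‖twoPointCount Q N v (f 0) (f 1)‖ ^ 2 ≤ (N : ℝ) ^ D * E →
      δ ^ 2 * (N : ℝ) ^ D ≤ E := by
    intro E hE
    have h1 : (δ * (N : ℝ) ^ D) ^ 2 ≤ (N : ℝ) ^ D * E := le_trans (by gcongr) hE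
    refine le_of_mul_le_mul_left ?_ hND
    calc _ = (δ * (N : ℝ) ^ D) ^ 2 := by ring
      _ ≤ _ := h1
  apply key
  match i with
  | 0 =>
    rw [← tsum_norm_expect_sq_neg (hf' 0).finite, twoPointCount, tsum_expect_comm (hf' 0).finite]
    refine norm_tsum_mul_sq_le (hf 1) (hf' 1) ?_
    simpa only [sub_eq_add_neg] using
      finite_support_expect (hf' 0).finite _ fun z => -(Q.eval z • v)
  | 1 =>
    unfold twoPointCount
    simp only [← Finset.mul_expect]
    exact norm_tsum_mul_sq_le (hf 0) (hf' 0) (finite_support_expect (hf' 1).finite _ _)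

theorem le_progressionMean {D q : ℕ} {N' : ℝ} {v : Fin D → ℤ} {f : (Fin D → ℤ) → ℂ}
    (hf : OneBounded f) (hfin : f.support.Finite) :
    ∑' x, ‖𝔼 z ∈ seg N', f (x + ((q : ℤ) * z) • v)‖ ^ 2 ≤ progressionMean q N' v f := by
  have hsupp := finite_support_expect hfin (seg N') fun z => ((q : ℤ) * z) • v
  refine Summable.tsum_le_tsum (fun x => ?_)
    (summable_of_hasFiniteSupport (hsupp.subset fun x hx h => hx (by
      change ‖(fun x => 𝔼 z ∈ seg N', f (x + ((q : ℤ) * z) • v)) x‖ ^ 2 = 0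
      rw [h]; simp)))
    (summable_of_hasFiniteSupport (hsupp.subset fun x hx h => hx (norm_eq_zero.2 h)))
  have h1 := norm_expect_le_of_forall_le (seg N') (fun z => f (x + ((q : ℤ) * z) • v)) zero_le_one
    fun z _ => hf _
  rw [sq]
  exact mul_le_of_le_one_left (norm_nonneg _) h1

theorem primeProd_pos (w : ℝ) : 0 < primeProd w :=
  Finset.prod_pos fun _ hp => (Finset.mem_filter.1 hp).2.pos

end PolyCorners

theorem corollaryE8 (P : Polynomial ℤ) (ρ : ℤ) (hρ : P.rootMultiplicity ρ = 1)
    (C₁ : ℝ) (hC₁ : 0 < C₁) :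
    ∃ C₂ : ℝ, 0 < C₂ ∧
      ∀ (D : ℕ) (B : ℝ), 0 < D → ∃ A : ℝ, 0 < A ∧
        ∀ (w δ : ℝ) (m V r N : ℕ) (v : Fin D → ℤ) (f : Fin 2 → (Fin D → ℤ) → ℂ),
          10 < w → 0 < δ → δ < 1 / 10 →
          V = PolyCorners.primeProd w ^ m → (V : ℝ) ≤ (PolyCorners.primeProd w : ℝ) ^ C₁ →
          r < V →
          C₂ * |((PolyCorners.vTrick (PolyCorners.wTrick P ρ (PolyCorners.primeProd w))
              r V).leadingCoeff : ℝ)| ^ C₂ * δ ^ (-C₂) ≤ (N : ℝ) →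
          (∀ j, |(v j : ℝ)| ≤ B) →
          (∀ i, PolyCorners.OneBounded (f i)) →
          (∀ i, PolyCorners.SupportedOnBox N (f i)) →
          δ * (N : ℝ) ^ D ≤
            ‖PolyCorners.twoPointCount
              (PolyCorners.vTrick (PolyCorners.wTrick P ρ (PolyCorners.primeProd w)) r V)
              N v (f 0) (f 1)‖ →
          ∀ i, ∃ q : ℕ, 0 < q ∧ (q : ℝ) ≤ A * δ ^ (-A) ∧
            ∀ N' : ℝ, 1 ≤ N' → N' ≤ δ ^ A * N →
              A⁻¹ * δ ^ A * (N : ℝ) ^ D ≤ PolyCorners.progressionMean q N' v (f i) := by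
  open PolyCorners in
  obtain ⟨C₂, c, B₀, hC₂, hB₀, hmajor⟩ := exists_major_arc P ρ hρ
  refine ⟨C₂, by exact_mod_cast hC₂, fun D B _ => ?_⟩
  -- `c + 2` absorbs the powers of `δ` that are lost, and `6 * B₀` the constants.
  set A : ℕ := c + 2 + 6 * B₀ with hA
  refine ⟨A, by exact_mod_cast (by omega : 0 < A), ?_⟩
  intro w δ m V r N v f _ hδ hδ' hV _ hr hN _ hf hf' hcount i
  have hδinv : 1 ≤ δ⁻¹ := (one_le_inv₀ hδ).2 (by linarith)
  have hδ1 : δ ≤ 1 := by linarith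
  rw [Real.rpow_neg hδ.le, Real.rpow_natCast, Real.rpow_natCast, ← inv_pow] at hN
  simp only [Real.rpow_neg hδ.le, Real.rpow_natCast, ← inv_pow]
  have hB₀R : (1 : ℝ) ≤ B₀ := by exact_mod_cast hB₀
  set Q := vTrick (wTrick P ρ (primeProd w)) r V with hQ
  obtain ⟨hNpos, hlarge⟩ :=
    hmajor (primeProd w) m V r N δ (primeProd_pos w) hV hr hδ hδ' hN
  have hNR : (0 : ℝ) < N := by exact_mod_cast hNpos
  set Y : ℝ := B₀ * δ⁻¹ ^ c with hY
  have hY1 : 1 ≤ Y := one_le_mul_of_one_le_of_one_le hB₀R (one_le_pow₀ hδinv)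
  set R := ⌊Y⌋₊ with hR
  have hR0 : 0 < R := Nat.floor_pos.2 hY1
  have hRY : (R : ℝ) ≤ Y := Nat.floor_le (by linarith)
  obtain ⟨q, hq, hqE⟩ := exists_progression_energy (hf' i).finite v (seg (scale Q N))
    (fun z => Q.eval z) R (δ / 2) (Y / N) ((N : ℝ) ^ D) hR0 (tsum_norm_sq_le (hf i) (hf' i))
    (by
      intro u hu hle
      obtain ⟨q, hq0, hq1, hqu⟩ := hlarge u hu hle
      exact ⟨q, Finset.mem_Icc.2 ⟨hq0, Nat.le_floor hq1⟩, hqu⟩)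
    (by
      refine le_trans (le_of_eq ?_) (le_tsum_norm_expect_sq hNpos hδ.le hf hf' hcount i)
      ring)
  rw [Finset.mem_Icc] at hq
  have hAB : B₀ ≤ A := by omega
  have hδc : δ⁻¹ ^ c * δ ^ c = 1 := by rw [← mul_pow, inv_mul_cancel₀ hδ.ne', one_pow]
  refine ⟨q, hq.1, ?_, fun N' hN'1 hN' => ?_⟩
  · calc (q : ℝ) ≤ Y := (Nat.cast_le.2 hq.2).trans hRY
      _ ≤ A * δ⁻¹ ^ A := by
        rw [hY]
        have : c ≤ A := by omega
        gcongr
  · have hhalf : δ ^ A * Y ≤ 1 / 2 := by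
      have h1 : δ ^ (2 + 6 * B₀) ≤ (1 / 2) ^ (2 + 6 * B₀) := by gcongr; linarith
      have h2 : (2 * B₀ : ℝ) < 2 ^ (2 + 6 * B₀) := by
        have : 2 + 6 * B₀ < 2 ^ (2 + 6 * B₀) := Nat.lt_two_pow_self
        have h3 : 2 * B₀ < 2 ^ (2 + 6 * B₀) := by omega
        exact_mod_cast h3
      calc δ ^ A * Y = (δ⁻¹ ^ c * δ ^ c) * (B₀ * δ ^ (2 + 6 * B₀)) := by
            rw [hA, hY, add_assoc, pow_add]; ring
        _ = B₀ * δ ^ (2 + 6 * B₀) := by rw [hδc, one_mul]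
        _ ≤ B₀ * (1 / 2) ^ (2 + 6 * B₀) := by gcongr
        _ ≤ 1 / 2 := by
            rw [one_div, inv_pow, ← div_eq_mul_inv, div_le_iff₀ (by positivity)]
            linarith
    have hseg : (seg N').Nonempty := by
      refine ⟨0, ?_⟩
      rw [seg, Finset.mem_Icc]
      exact ⟨le_rfl, Int.floor_nonneg.2 (by linarith)⟩
    refine le_trans ?_ ((hqE (seg N') hseg ?_).trans (le_progressionMean (hf i) (hf' i).finite))
    · have hAR : (6 * B₀ : ℝ) ≤ A := by exact_mod_cast (by omega : 6 * B₀ ≤ A)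
      have hApos : (0 : ℝ) < A := by linarith
      have h1 : (A : ℝ)⁻¹ * δ ^ A ≤ 3 / 4 * (δ / 2) ^ 2 / R := by
        rw [le_div_iff₀ (by exact_mod_cast hR0)]
        have h2 : δ ^ A ≤ δ ^ (c + 2) := pow_le_pow_of_le_one hδ.le hδ1 (by omega)
        calc (A : ℝ)⁻¹ * δ ^ A * R ≤ (6 * B₀ : ℝ)⁻¹ * δ ^ (c + 2) * Y := by gcongr
          _ = (6 * B₀ : ℝ)⁻¹ * B₀ * (δ⁻¹ ^ c * δ ^ c) * δ ^ 2 := by rw [hY, pow_add]; ring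
          _ = 1 / 6 * δ ^ 2 := by rw [hδc]; field_simp
          _ ≤ _ := by nlinarith [sq_nonneg δ]
      calc _ ≤ 3 / 4 * (δ / 2) ^ 2 / R * (N : ℝ) ^ D := by gcongr
        _ = _ := by ring
    · intro z hz
      rw [seg, Finset.mem_Icc] at hz
      refine ⟨hz.1, ?_⟩
      have h1 : (z : ℝ) ≤ N' := by
        have := Int.le_floor.1 hz.2
        linarith
      calc (z : ℝ) * (Y / N) ≤ (δ ^ A * N) * (Y / N) := by
            gcongr
            exact h1.trans hN'
        _ = δ ^ A * Y := by field_simp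
        _ ≤ 1 / 2 := hhalf
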